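/- All categories below have the finite ordinals $\mathbf n=\{0,\dots,n-1\}$, $n\in\mathbb N$, as objects and are symmetric strict monoidal with tensor product $\mathbf n\oplus\mathbf m=\mathbf{n+m}$ (that is, they are PROPs). - $\mathbf P$: morphisms $\mathbf n\to\mathbf m$ are bijections (the initial PROP). - $\mathbf D$: morphisms $\mathbf n\to\mathbf m$ are relations $R\subseteq \mathbf n\times\mathbf m$ (the free PROP on degenerate commutative bialgebras). - $\mathbf N$: morphisms $\mathbf n\to\mathbf m$ are pairs $(\sigma,w)$ of a bijection $\sigma:\mathbf n\to\mathbf m$ and a family $w\in\mathbb N^{n}$ of words in one letter (given by their lengths), with $(\tau,w)\circ(\sigma,v)=(\tau\sigma,(w_{\sigma(i)}+v_i)_i)$ (the free PROP on a node $\lambda=(\mathrm{id}_1,1):\mathbf 1\to\mathbf 1$). - $\mathbf{Dag}$: an $(\mathbf n,\mathbf m)$-dag is a finite set $N$ of internal nodes with a relation $R\subseteq(\mathbf n+N)\times(\mathbf m+N)$ whose restriction to $N$ is acyclic; morphisms $\mathbf n\to\mathbf m$ are isomorphism classes of $(\mathbf n,\mathbf m)$-dags, composition is concatenation (edges into the common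 interface are redirected along the edges leaving it) and the tensor product is juxtaposition. Consider the following symmetric strict monoidal, identity-on-objects functors. $\mathbf P\to\mathbf D$ sends a bijection to its graph, $\mathbf P\to\mathbf N$ decorates a bijection with empty words, $\mathbf D\to\mathbf{Dag}$ regards a relation as a dag without internal nodes, and $\mathbf N\to\mathbf{Dag}$ sends $(\sigma,w)$ to the disjoint union over $i$ of the paths from the input $i$ through $w_i$ internal nodes to the output $\sigma(i)$; so $\lambda$ goes to the dag $0\to\bullet\to 0$ with one internal node. All four functors are injective on morphisms, and the square $$\begin{array}{ccc}\mathbf P&\to&\mathbf N\\ \downarrow&&\downarrow\\ \mathbf D&\to&\mathbf{Dag}\end{array}$$ is a pushout of symmetric monoidal categories: it commutes, and for every symmetric monoidal category $\mathcal C$ and all (strong) symmetric monoidal functors $F:\mathbf D\to\mathcal C$, $H:\mathbf N\to\mathcal C$ with the same restriction $G$ to $\mathbf P$ there is a unique (strong) symmetric monoidal functor $K:\mathbf{Dag}\to\mathcal C$ that restricts to $F$ on $\mathbf D$ and to $H$ on $\mathbf N$ (all equalities being equalities of symmetric monoidal functors, including their structure isomorphisms). Moreover, put $A=G(\mathbf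 1)$ and $\lambda_A=H(\lambda):A\to A$, let $A^{\otimes n}\cong G(\mathbf n)$ be the canonical isomorphisms, and for a relation $R:\mathbf a\to\mathbf b$ let $[\![R]\!]_A$ be the composite $A^{\otimes a}\cong F(\mathbf a)\xrightarrow{F(R)}F(\mathbf b)\cong A^{\otimes b}$. Every $(\mathbf n,\mathbf m)$-dag $D=(N,R)$ has a topological sorting, that is, a bijection $\sigma:\{0,\dots,|N|-1\}\to N$ such that $(\sigma_i,\sigma_j)\in R$ implies $i<j$; and for every topological sorting $\sigma$ of $D$ the functor $K$ sends the class of $D$ to the composite $$G(\mathbf n)\cong A^{\otimes n}\xrightarrow{\ [\![R^\sigma_{|N|}]\!]_A\circ(\mathrm{id}\otimes\lambda_A)\circ[\![R^\sigma_{|N|-1}]\!]_A\circ\cdots\circ(\mathrm{id}\otimes\lambda_A)\circ[\![R^\sigma_0]\!]_A\ }A^{\otimes m}\cong G(\mathbf m).$$ Here, identifying position $n+l$ with the node $\sigma_l$, for $k<|N|$ the relation $R^\sigma_k:\mathbf{n+k}\to\mathbf{n+k+1}$ consists of the pairs $(x,x)$ together with the pairs $(x,n+k)$ such that $R$ has an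 edge from $x$ to the node $\sigma_k$, and $R^\sigma_{|N|}:\mathbf{n+|N|}\to\mathbf m$ consists of the edges of $R$ from inputs and internal nodes to outputs. -/

import Mathlib

open CategoryTheory MonoidalCategory

universe w w' v u v₁ u₁ v₂ u₂ v₃ u₃

/-- Morphisms between (finite) sets that can be relabelled along bijections, composed, and put
side by side. Such a system yields a PROP by restriction to the finite ordinals, see
`PropSystem.Cat`. -/
structure PropSystem where
  Hom : Type → Type → Type w
  /-- the relabelling morphism given by a bijection -/
  ofEquiv {I O : Type} : I ≃ O → Hom I O
  /-- composition in diagrammatic order -/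
  comp {I M O : Type} : Hom I M → Hom M O → Hom I O
  /-- juxtaposition -/
  tens {I O I' O' : Type} : Hom I O → Hom I' O' → Hom (I ⊕ I') (O ⊕ O')
  comp_assoc {I M M' O : Type} (f : Hom I M) (g : Hom M M') (h : Hom M' O) :
    comp (comp f g) h = comp f (comp g h)
  refl_comp {I O : Type} (f : Hom I O) : comp (ofEquiv (Equiv.refl I)) f = f
  comp_refl {I O : Type} (f : Hom I O) : comp f (ofEquiv (Equiv.refl O)) = f
  ofEquiv_comp {I M O : Type} (e : I ≃ M) (e' : M ≃ O) :
    comp (ofEquiv e) (ofEquiv e') = ofEquiv (e.trans e')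
  tens_ofEquiv {I O I' O' : Type} (e : I ≃ O) (e' : I' ≃ O') :
    tens (ofEquiv e) (ofEquiv e') = ofEquiv (Equiv.sumCongr e e')
  tens_comp {I M O I' M' O' : Type} (f : Hom I M) (g : Hom M O) (f' : Hom I' M')
    (g' : Hom M' O') : comp (tens f f') (tens g g') = tens (comp f g) (comp f' g')
  tens_assoc {I O I' O' I'' O'' : Type} (f : Hom I O) (g : Hom I' O') (h : Hom I'' O'') :
    comp (tens (tens f g) h) (ofEquiv (Equiv.sumAssoc O O' O'')) =
      comp (ofEquiv (Equiv.sumAssoc I I' I'')) (tens f (tens g h))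
  empty_tens {I O : Type} (f : Hom I O) :
    comp (tens (ofEquiv (Equiv.refl (Fin 0))) f) (ofEquiv (Equiv.emptySum (Fin 0) O)) =
      comp (ofEquiv (Equiv.emptySum (Fin 0) I)) f
  tens_empty {I O : Type} (f : Hom I O) :
    comp (tens f (ofEquiv (Equiv.refl (Fin 0)))) (ofEquiv (Equiv.sumEmpty O (Fin 0))) =
      comp (ofEquiv (Equiv.sumEmpty I (Fin 0))) f
  tens_comm {I O I' O' : Type} (f : Hom I O) (g : Hom I' O') :
    comp (tens f g) (ofEquiv (Equiv.sumComm O O')) =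
      comp (ofEquiv (Equiv.sumComm I I')) (tens g f)

namespace PropSystem

/-- The objects of the PROP of `P`: the finite ordinals, that is, the natural numbers. -/
@[ext]
structure Cat (P : PropSystem.{w}) : Type where
  ord : ℕ

variable (P : PropSystem.{w})

/-- The PROP of `P` is the full subcategory on the sets `Fin n`. -/
instance : Category.{w} P.Cat where
  Hom X Y := P.Hom (Fin X.ord) (Fin Y.ord)
  id X := P.ofEquiv (Equiv.refl (Fin X.ord))
  comp f g := P.comp f g
  id_comp f := P.refl_comp f
  comp_id f := P.comp_refl f
  assoc f g h := P.comp_assoc f g h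

variable {P}

/-- The isomorphism of the PROP given by a bijection of finite ordinals. -/
def permIso {X Y : P.Cat} (e : Fin X.ord ≃ Fin Y.ord) : X ≅ Y where
  hom := P.ofEquiv e
  inv := P.ofEquiv e.symm
  hom_inv_id := (P.ofEquiv_comp _ _).trans (by rw [Equiv.self_trans_symm]; rfl)
  inv_hom_id := (P.ofEquiv_comp _ _).trans (by rw [Equiv.symm_trans_self]; rfl)

/-- Tensor product of morphisms: juxtaposition, with `Fin n ⊕ Fin m` identified with
`Fin (n + m)`. -/
def tensMap {a b c d : ℕ} (f : P.Hom (Fin a) (Fin b)) (g : P.Hom (Fin c) (Fin d)) :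
    P.Hom (Fin (a + c)) (Fin (b + d)) :=
  P.comp (P.ofEquiv finSumFinEquiv.symm) (P.comp (P.tens f g) (P.ofEquiv finSumFinEquiv))

theorem tensMap_ofEquiv {a b c d : ℕ} (e : Fin a ≃ Fin b) (e' : Fin c ≃ Fin d) :
    tensMap (P.ofEquiv e) (P.ofEquiv e') =
      P.ofEquiv (finSumFinEquiv.symm.trans ((Equiv.sumCongr e e').trans finSumFinEquiv)) := by
  simp only [tensMap, P.tens_ofEquiv, P.ofEquiv_comp]

theorem ofEquiv_comp_assoc {I M M' O : Type} (e : I ≃ M) (e' : M ≃ M') (f : P.Hom M' O) :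
    P.comp (P.ofEquiv e) (P.comp (P.ofEquiv e') f) = P.comp (P.ofEquiv (e.trans e')) f := by
  rw [← P.comp_assoc, P.ofEquiv_comp]

theorem tensMap_comp {a b c a' b' c' : ℕ} (f : P.Hom (Fin a) (Fin b)) (g : P.Hom (Fin b) (Fin c))
    (f' : P.Hom (Fin a') (Fin b')) (g' : P.Hom (Fin b') (Fin c')) :
    P.comp (tensMap f f') (tensMap g g') = tensMap (P.comp f g) (P.comp f' g') := by
  simp only [tensMap, P.comp_assoc, ofEquiv_comp_assoc, Equiv.self_trans_symm, P.refl_comp,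
    ← P.tens_comp]

/-- Bijections can be moved past a morphism with known naturality. -/
theorem tens_assoc' {I O I' O' I'' O'' Z : Type} (f : P.Hom I O) (g : P.Hom I' O')
    (h : P.Hom I'' O'') (k : P.Hom _ Z) :
    P.comp (P.tens (P.tens f g) h) (P.comp (P.ofEquiv (Equiv.sumAssoc O O' O'')) k) =
      P.comp (P.ofEquiv (Equiv.sumAssoc I I' I'')) (P.comp (P.tens f (P.tens g h)) k) := by
  rw [← P.comp_assoc, P.tens_assoc, P.comp_assoc]

variable (P)

instance : MonoidalCategoryStruct P.Cat where
  tensorObj X Y := ⟨X.ord + Y.ord⟩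
  tensorHom f g := tensMap f g
  whiskerLeft X _ _ f := tensMap (P.ofEquiv (Equiv.refl (Fin X.ord))) f
  whiskerRight f Y := tensMap f (P.ofEquiv (Equiv.refl (Fin Y.ord)))
  tensorUnit := ⟨0⟩
  associator X Y Z := permIso (finCongr (Nat.add_assoc X.ord Y.ord Z.ord))
  leftUnitor X := permIso (finCongr (Nat.zero_add X.ord))
  rightUnitor X := permIso (finCongr (Nat.add_zero X.ord))


variable {P}

theorem tens_conj_left {I I₀ O O₀ I' O' : Type} (e : I ≃ I₀) (f : P.Hom I₀ O₀) (e' : O₀ ≃ O)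
    (h : P.Hom I' O') :
    P.tens (P.comp (P.ofEquiv e) (P.comp f (P.ofEquiv e'))) h =
      P.comp (P.ofEquiv (Equiv.sumCongr e (Equiv.refl _)))
        (P.comp (P.tens f h) (P.ofEquiv (Equiv.sumCongr e' (Equiv.refl _)))) := by
  rw [← P.tens_ofEquiv, ← P.tens_ofEquiv, P.tens_comp, P.tens_comp, P.comp_refl, P.refl_comp]

theorem tens_conj_right {I I₀ O O₀ I' O' : Type} (e : I ≃ I₀) (f : P.Hom I₀ O₀) (e' : O₀ ≃ O)
    (h : P.Hom I' O') :
    P.tens h (P.comp (P.ofEquiv e) (P.comp f (P.ofEquiv e'))) =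
      P.comp (P.ofEquiv (Equiv.sumCongr (Equiv.refl _) e))
        (P.comp (P.tens h f) (P.ofEquiv (Equiv.sumCongr (Equiv.refl _) e'))) := by
  rw [← P.tens_ofEquiv, ← P.tens_ofEquiv, P.tens_comp, P.tens_comp, P.comp_refl, P.refl_comp]

theorem finSum_assoc (a b c : ℕ) :
    (Equiv.sumCongr finSumFinEquiv (Equiv.refl (Fin c))).trans
        (finSumFinEquiv.trans (finCongr (Nat.add_assoc a b c))) =
      (Equiv.sumAssoc (Fin a) (Fin b) (Fin c)).trans
        ((Equiv.sumCongr (Equiv.refl (Fin a)) finSumFinEquiv).trans finSumFinEquiv) := by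
  ext x
  rcases x with (x | x) | x <;> simp [Nat.add_assoc]

theorem finSum_assoc' (a b c : ℕ) :
    finSumFinEquiv.symm.trans
        ((Equiv.sumCongr finSumFinEquiv.symm (Equiv.refl (Fin c))).trans
          (Equiv.sumAssoc (Fin a) (Fin b) (Fin c))) =
      (finCongr (Nat.add_assoc a b c)).trans (finSumFinEquiv.symm.trans
        (Equiv.sumCongr (Equiv.refl (Fin a)) finSumFinEquiv.symm)) := by
  have h := congrArg Equiv.symm (finSum_assoc a b c)
  have h2 : (Equiv.sumAssoc (Fin a) (Fin b) (Fin c)).symm.trans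
      ((Equiv.sumCongr finSumFinEquiv (Equiv.refl (Fin c))).trans
        (finSumFinEquiv.trans (finCongr (Nat.add_assoc a b c)))) =
      (Equiv.sumCongr (Equiv.refl (Fin a)) finSumFinEquiv).trans finSumFinEquiv := by
    rw [finSum_assoc, ← Equiv.trans_assoc, Equiv.symm_trans_self, Equiv.refl_trans]
  have h3 := congrArg Equiv.symm h2
  simp only [Equiv.symm_trans, Equiv.symm_symm, Equiv.sumCongr_symm, Equiv.refl_symm] at h3
  rw [← h3]
  simp only [← Equiv.trans_assoc, Equiv.self_trans_symm, Equiv.refl_trans]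

theorem tensMap_assoc {a b a' b' a'' b'' : ℕ} (f : P.Hom (Fin a) (Fin b))
    (g : P.Hom (Fin a') (Fin b')) (h : P.Hom (Fin a'') (Fin b'')) :
    P.comp (tensMap (tensMap f g) h) (P.ofEquiv (finCongr (Nat.add_assoc b b' b''))) =
      P.comp (P.ofEquiv (finCongr (Nat.add_assoc a a' a''))) (tensMap f (tensMap g h)) := by
  simp only [tensMap, tens_conj_left, tens_conj_right, P.comp_assoc, P.ofEquiv_comp,
    ofEquiv_comp_assoc, Equiv.trans_assoc, finSum_assoc]
  rw [← P.ofEquiv_comp (Equiv.sumAssoc _ _ _), tens_assoc']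
  simp only [ofEquiv_comp_assoc, Equiv.trans_assoc, finSum_assoc']

theorem tensMap_refl_finCongr {a c d : ℕ} (h : c = d) :
    tensMap (P.ofEquiv (Equiv.refl (Fin a))) (P.ofEquiv (finCongr h)) =
      P.ofEquiv (finCongr (congrArg (a + ·) h)) := by
  subst h
  rw [tensMap_ofEquiv]
  congr 1
  ext x
  simp

theorem tensMap_finCongr_refl {a c d : ℕ} (h : c = d) :
    tensMap (P.ofEquiv (finCongr h)) (P.ofEquiv (Equiv.refl (Fin a))) =
      P.ofEquiv (finCongr (congrArg (· + a) h)) := by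
  subst h
  rw [tensMap_ofEquiv]
  congr 1
  ext x
  simp

theorem finSum_zero_add (a : ℕ) :
    finSumFinEquiv.trans (finCongr (Nat.zero_add a)) = Equiv.emptySum (Fin 0) (Fin a) := by
  ext x
  rcases x with x | x
  · exact x.elim0
  · simp

theorem finSum_add_zero (a : ℕ) :
    finSumFinEquiv.trans (finCongr (Nat.add_zero a)) = Equiv.sumEmpty (Fin a) (Fin 0) := by
  ext x
  rcases x with x | x
  · rw [Equiv.trans_apply, finSumFinEquiv_apply_left]
    simp
  · exact x.elim0

theorem zero_tensMap {a b : ℕ} (f : P.Hom (Fin a) (Fin b)) :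
    P.comp (tensMap (P.ofEquiv (Equiv.refl (Fin 0))) f) (P.ofEquiv (finCongr (Nat.zero_add b))) =
      P.comp (P.ofEquiv (finCongr (Nat.zero_add a))) f := by
  simp only [tensMap, P.comp_assoc, P.ofEquiv_comp, finSum_zero_add, P.empty_tens,
    ofEquiv_comp_assoc]
  rw [← finSum_zero_add, ← Equiv.trans_assoc, Equiv.symm_trans_self, Equiv.refl_trans]

theorem tensMap_zero {a b : ℕ} (f : P.Hom (Fin a) (Fin b)) :
    P.comp (tensMap f (P.ofEquiv (Equiv.refl (Fin 0)))) (P.ofEquiv (finCongr (Nat.add_zero b))) =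
      P.comp (P.ofEquiv (finCongr (Nat.add_zero a))) f := by
  simp only [tensMap, P.comp_assoc, P.ofEquiv_comp, finSum_add_zero, P.tens_empty,
    ofEquiv_comp_assoc]
  rw [← finSum_add_zero, ← Equiv.trans_assoc, Equiv.symm_trans_self, Equiv.refl_trans]

variable (P)

instance : MonoidalCategory P.Cat :=
  MonoidalCategory.ofTensorHom
    (id_tensorHom_id := fun X Y => by
      refine (tensMap_refl_finCongr (P := P) (a := X.ord) (rfl : Y.ord = Y.ord)).trans ?_
      rfl)
    (id_tensorHom := fun _ _ _ _ => rfl)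
    (tensorHom_id := fun _ _ => rfl)
    (tensorHom_comp_tensorHom := fun f₁ f₂ g₁ g₂ => tensMap_comp f₁ g₁ f₂ g₂)
    (associator_naturality := fun f g h => tensMap_assoc f g h)
    (leftUnitor_naturality := fun f => zero_tensMap f)
    (rightUnitor_naturality := fun f => tensMap_zero f)
    (pentagon := fun W X Y Z => by
      change P.comp (tensMap (P.ofEquiv (finCongr _)) (P.ofEquiv (Equiv.refl _)))
        (P.comp (P.ofEquiv (finCongr _))
          (tensMap (P.ofEquiv (Equiv.refl _)) (P.ofEquiv (finCongr _)))) =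
        P.comp (P.ofEquiv (finCongr _)) (P.ofEquiv (finCongr _))
      rw [tensMap_finCongr_refl, tensMap_refl_finCongr, P.ofEquiv_comp, P.ofEquiv_comp,
        P.ofEquiv_comp]
      rfl)
    (triangle := fun X Y => by
      change P.comp (P.ofEquiv (finCongr _))
        (tensMap (P.ofEquiv (Equiv.refl _)) (P.ofEquiv (finCongr _))) =
        tensMap (P.ofEquiv (finCongr _)) (P.ofEquiv (Equiv.refl _))
      rw [tensMap_finCongr_refl, tensMap_refl_finCongr, P.ofEquiv_comp]
      rfl)

/-- The block transposition `Fin (a + b) ≃ Fin (b + a)`. -/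
def blockSwap (a b : ℕ) : Fin (a + b) ≃ Fin (b + a) :=
  finSumFinEquiv.symm.trans ((Equiv.sumComm (Fin a) (Fin b)).trans finSumFinEquiv)

variable {P}

theorem tensMap_comm {a b a' b' : ℕ} (f : P.Hom (Fin a) (Fin b)) (g : P.Hom (Fin a') (Fin b')) :
    P.comp (tensMap f g) (P.ofEquiv (blockSwap b b')) =
      P.comp (P.ofEquiv (blockSwap a a')) (tensMap g f) := by
  simp only [tensMap, blockSwap, P.comp_assoc, P.ofEquiv_comp, ofEquiv_comp_assoc,
    Equiv.trans_assoc, ← Equiv.trans_assoc finSumFinEquiv, Equiv.self_trans_symm,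
    Equiv.refl_trans, Equiv.trans_refl]
  rw [← P.ofEquiv_comp (Equiv.sumComm _ _), ← P.comp_assoc (P.tens f g), P.tens_comm,
    P.comp_assoc, ofEquiv_comp_assoc]

theorem blockSwap_castAdd (a b : ℕ) (i : Fin a) :
    blockSwap a b (Fin.castAdd b i) = Fin.natAdd b i := by
  simp [blockSwap]

theorem blockSwap_natAdd (a b : ℕ) (i : Fin b) :
    blockSwap a b (Fin.natAdd a i) = Fin.castAdd a i := by
  simp [blockSwap]

theorem finCongr_assoc_left (a b c : ℕ) (i : Fin a) :
    finCongr (Nat.add_assoc a b c) (Fin.castAdd c (Fin.castAdd b i)) = Fin.castAdd (b + c) i :=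
  rfl

theorem finCongr_assoc_mid (a b c : ℕ) (i : Fin b) :
    finCongr (Nat.add_assoc a b c) (Fin.castAdd c (Fin.natAdd a i)) =
      Fin.natAdd a (Fin.castAdd c i) :=
  rfl

theorem finCongr_assoc_right (a b c : ℕ) (i : Fin c) :
    finCongr (Nat.add_assoc a b c) (Fin.natAdd (a + b) i) = Fin.natAdd a (Fin.natAdd b i) :=
  Fin.ext (Nat.add_assoc a b i)

/-- Bijections out of `Fin (a + b + c)` are determined on the three blocks. -/
theorem equiv_ext_three {a b c : ℕ} {O : Type} {e e' : Fin (a + b + c) ≃ O}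
    (h₁ : ∀ i : Fin a, e (Fin.castAdd c (Fin.castAdd b i)) = e' (Fin.castAdd c (Fin.castAdd b i)))
    (h₂ : ∀ i : Fin b, e (Fin.castAdd c (Fin.natAdd a i)) = e' (Fin.castAdd c (Fin.natAdd a i)))
    (h₃ : ∀ i : Fin c, e (Fin.natAdd (a + b) i) = e' (Fin.natAdd (a + b) i)) : e = e' :=
  Equiv.ext fun i => Fin.addCases (fun i => Fin.addCases h₁ h₂ i) h₃ i

theorem blockSwap_hexagon (a b c : ℕ) :
    (finCongr (Nat.add_assoc a b c)).trans ((blockSwap a (b + c)).trans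
        (finCongr (Nat.add_assoc b c a))) =
      (finSumFinEquiv.symm.trans ((Equiv.sumCongr (blockSwap a b) (Equiv.refl (Fin c))).trans
        finSumFinEquiv)).trans ((finCongr (Nat.add_assoc b a c)).trans
          (finSumFinEquiv.symm.trans ((Equiv.sumCongr (Equiv.refl (Fin b)) (blockSwap a c)).trans
            finSumFinEquiv))) := by
  apply equiv_ext_three <;> intro i
  · simp only [Equiv.trans_apply, finCongr_assoc_left, blockSwap_castAdd, finCongr_assoc_mid,
      finSumFinEquiv_symm_apply_castAdd, Equiv.sumCongr_apply, Sum.map_inl,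
      finSumFinEquiv_apply_left, finCongr_assoc_right, finSumFinEquiv_symm_apply_natAdd,
      Sum.map_inr, finSumFinEquiv_apply_right]
  · simp only [Equiv.trans_apply, finCongr_assoc_left, blockSwap_natAdd, finCongr_assoc_mid,
      finSumFinEquiv_symm_apply_castAdd, Equiv.sumCongr_apply, Sum.map_inl,
      finSumFinEquiv_apply_left, Equiv.refl_apply]
  · simp only [Equiv.trans_apply, finCongr_assoc_right, blockSwap_natAdd, finCongr_assoc_mid,
      finSumFinEquiv_symm_apply_natAdd, Equiv.sumCongr_apply, Sum.map_inr,
      finSumFinEquiv_apply_right, Equiv.refl_apply]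

theorem blockSwap_symm (a b : ℕ) : (blockSwap a b).symm = blockSwap b a := rfl

variable (P)

instance : BraidedCategory P.Cat where
  braiding X Y := permIso (blockSwap X.ord Y.ord)
  braiding_naturality_right X _ _ f := tensMap_comm (P.ofEquiv (Equiv.refl (Fin X.ord))) f
  braiding_naturality_left f Z := tensMap_comm f (P.ofEquiv (Equiv.refl (Fin Z.ord)))
  hexagon_forward X Y Z := by
    change P.comp (P.ofEquiv (finCongr _)) (P.comp (P.ofEquiv (blockSwap _ (Y.ord + Z.ord)))
      (P.ofEquiv (finCongr _))) = P.comp (tensMap (P.ofEquiv (blockSwap _ _))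
        (P.ofEquiv (Equiv.refl _))) (P.comp (P.ofEquiv (finCongr _))
          (tensMap (P.ofEquiv (Equiv.refl _)) (P.ofEquiv (blockSwap _ _))))
    simp only [tensMap_ofEquiv, P.ofEquiv_comp]
    exact congrArg P.ofEquiv (blockSwap_hexagon X.ord Y.ord Z.ord)
  hexagon_reverse X Y Z := by
    change P.comp (P.ofEquiv (finCongr _).symm) (P.comp (P.ofEquiv (blockSwap (X.ord + Y.ord) _))
      (P.ofEquiv (finCongr _).symm)) = P.comp (tensMap (P.ofEquiv (Equiv.refl _))
        (P.ofEquiv (blockSwap _ _))) (P.comp (P.ofEquiv (finCongr _).symm)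
          (tensMap (P.ofEquiv (blockSwap _ _)) (P.ofEquiv (Equiv.refl _))))
    simp only [tensMap_ofEquiv, P.ofEquiv_comp]
    exact congrArg (fun e => P.ofEquiv (Equiv.symm e)) (blockSwap_hexagon Z.ord X.ord Y.ord)

instance : SymmetricCategory P.Cat where
  symmetry X Y := (permIso (P := P) (X := ⟨X.ord + Y.ord⟩) (Y := ⟨Y.ord + X.ord⟩)
    (blockSwap X.ord Y.ord)).hom_inv_id

theorem permIso_eqToIso {X Y : P.Cat} (h : X = Y) :
    eqToIso h = permIso (finCongr (congrArg Cat.ord h)) := by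
  subst h
  rfl

/-- The monoidal structure of `P.Cat` is strict. -/
theorem associator_strict (X Y Z : P.Cat) :
    α_ X Y Z = eqToIso (Cat.ext (Nat.add_assoc X.ord Y.ord Z.ord)) :=
  (permIso_eqToIso P _).symm

theorem leftUnitor_strict (X : P.Cat) : λ_ X = eqToIso (Cat.ext (Nat.zero_add X.ord)) :=
  (permIso_eqToIso P _).symm

theorem rightUnitor_strict (X : P.Cat) : ρ_ X = eqToIso (Cat.ext (Nat.add_zero X.ord)) :=
  (permIso_eqToIso P _).symm

end PropSystem

/-- Bundled (strong) symmetric monoidal functors. -/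
structure SymMonFunctor (C : Type u₁) [Category.{v₁} C] [MonoidalCategory C] [SymmetricCategory C]
    (D : Type u₂) [Category.{v₂} D] [MonoidalCategory D] [SymmetricCategory D] where
  functor : C ⥤ D
  [braided : functor.Braided]

namespace SymMonFunctor

attribute [instance] SymMonFunctor.braided

variable {C : Type u₁} [Category.{v₁} C] [MonoidalCategory C] [SymmetricCategory C]
  {D : Type u₂} [Category.{v₂} D] [MonoidalCategory D] [SymmetricCategory D]
  {E : Type u₃} [Category.{v₃} E] [MonoidalCategory E] [SymmetricCategory E]

/-- Composition, in diagrammatic order. -/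
def comp (F : SymMonFunctor C D) (G : SymMonFunctor D E) : SymMonFunctor C E where
  functor := F.functor ⋙ G.functor

/-- Equal functors have equal values. -/
theorem obj_eq {F G : SymMonFunctor C D} (h : F = G) (X : C) :
    F.functor.obj X = G.functor.obj X := by
  rw [h]

end SymMonFunctor

/-- A family of maps of morphisms that commutes with relabelling, composition and juxtaposition;
it induces a morphism of PROPs. -/
structure PropMap (P : PropSystem.{w}) (Q : PropSystem.{w'}) where
  map {I O : Type} [Finite I] [Finite O] : P.Hom I O → Q.Hom I O
  map_ofEquiv {I O : Type} [Finite I] [Finite O] (e : I ≃ O) :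
    map (P.ofEquiv e) = Q.ofEquiv e
  map_comp {I M O : Type} [Finite I] [Finite M] [Finite O] (f : P.Hom I M) (g : P.Hom M O) :
    map (P.comp f g) = Q.comp (map f) (map g)
  map_tens {I O I' O' : Type} [Finite I] [Finite O] [Finite I'] [Finite O'] (f : P.Hom I O)
    (g : P.Hom I' O') : map (P.tens f g) = Q.tens (map f) (map g)

namespace PropMap

variable {P : PropSystem.{w}} {Q : PropSystem.{w'}} (φ : PropMap P Q)

/-- The underlying functor is the identity on objects. -/
def functor : P.Cat ⥤ Q.Cat where
  obj X := ⟨X.ord⟩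
  map f := φ.map f
  map_id _ := φ.map_ofEquiv _
  map_comp f g := φ.map_comp f g

theorem map_tensMap {a b c d : ℕ} (f : P.Hom (Fin a) (Fin b)) (g : P.Hom (Fin c) (Fin d)) :
    φ.map (PropSystem.tensMap f g) = PropSystem.tensMap (φ.map f) (φ.map g) := by
  simp only [PropSystem.tensMap, φ.map_comp, φ.map_tens, φ.map_ofEquiv]

/-- The functor is strict monoidal: its structure maps are identities. -/
def coreMonoidal : φ.functor.CoreMonoidal where
  εIso := Iso.refl (⟨0⟩ : Q.Cat)
  μIso X Y := Iso.refl (⟨X.ord + Y.ord⟩ : Q.Cat)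
  μIso_hom_natural_left {X Y} f X' := by
    refine (Category.comp_id _).trans (Eq.trans ?_ (Category.id_comp _).symm)
    refine Eq.trans ?_ (φ.map_tensMap f (P.ofEquiv (Equiv.refl (Fin X'.ord)))).symm
    rw [φ.map_ofEquiv]
    rfl
  μIso_hom_natural_right {X Y} X' f := by
    refine (Category.comp_id _).trans (Eq.trans ?_ (Category.id_comp _).symm)
    refine Eq.trans ?_ (φ.map_tensMap (P.ofEquiv (Equiv.refl (Fin X'.ord))) f).symm
    rw [φ.map_ofEquiv]
    rfl
  associativity X Y Z := by
    have h : φ.functor.map (α_ X Y Z).hom =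
        (α_ (φ.functor.obj X) (φ.functor.obj Y) (φ.functor.obj Z)).hom := φ.map_ofEquiv _
    rw [h]
    change (𝟙 (φ.functor.obj X ⊗ φ.functor.obj Y)) ▷ φ.functor.obj Z ≫
      𝟙 ((φ.functor.obj X ⊗ φ.functor.obj Y) ⊗ φ.functor.obj Z) ≫ _ =
        _ ≫ φ.functor.obj X ◁ 𝟙 (φ.functor.obj Y ⊗ φ.functor.obj Z) ≫
          𝟙 (φ.functor.obj X ⊗ φ.functor.obj Y ⊗ φ.functor.obj Z)
    simp
  left_unitality X := by
    have h : φ.functor.map (λ_ X).hom = (λ_ (φ.functor.obj X)).hom := φ.map_ofEquiv _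
    rw [h]
    change _ = 𝟙 (𝟙_ Q.Cat) ▷ φ.functor.obj X ≫ 𝟙 (𝟙_ Q.Cat ⊗ φ.functor.obj X) ≫ _
    simp
  right_unitality X := by
    have h : φ.functor.map (ρ_ X).hom = (ρ_ (φ.functor.obj X)).hom := φ.map_ofEquiv _
    rw [h]
    change _ = φ.functor.obj X ◁ 𝟙 (𝟙_ Q.Cat) ≫ 𝟙 (φ.functor.obj X ⊗ 𝟙_ Q.Cat) ≫ _
    simp

instance : φ.functor.Braided where
  __ := φ.coreMonoidal.toMonoidal
  braided X Y := by
    have h : φ.functor.map (β_ X Y).hom = (β_ (φ.functor.obj X) (φ.functor.obj Y)).hom :=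
      φ.map_ofEquiv _
    rw [h]
    exact (Category.id_comp _).trans (Category.comp_id _).symm

/-- The morphism of PROPs as a symmetric monoidal functor. -/
def toSymMon : SymMonFunctor P.Cat Q.Cat where
  functor := φ.functor

end PropMap

/-! ### The four PROPs -/

/-- Bijections. -/
def permSystem : PropSystem.{0} where
  Hom I O := I ≃ O
  ofEquiv e := e
  comp f g := f.trans g
  tens f g := Equiv.sumCongr f g
  comp_assoc _ _ _ := rfl
  refl_comp _ := rfl
  comp_refl _ := rfl
  ofEquiv_comp _ _ := rfl
  tens_ofEquiv _ _ := rfl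
  tens_comp f g f' g' := by ext x; rcases x with x | x <;> rfl
  tens_assoc f g h := by ext x; rcases x with (x | x) | x <;> rfl
  empty_tens f := by
    ext x
    rcases x with x | x
    · exact x.elim0
    · rfl
  tens_empty f := by
    ext x
    rcases x with x | x
    · rfl
    · exact x.elim0
  tens_comm f g := by ext x; rcases x with x | x <;> rfl

theorem relComp_eq_left {I M O : Type} (e : I ≃ M) (R : M → O → Prop) :
    Relation.Comp (fun i j => e i = j) R = fun i o => R (e i) o := by
  funext i o
  simp [Relation.Comp]

theorem relComp_eq_right {I M O : Type} (e : M ≃ O) (R : I → M → Prop) :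
    Relation.Comp R (fun i j => e i = j) = fun i o => R i (e.symm o) := by
  funext i o
  simp only [Relation.Comp, eq_iff_iff]
  constructor
  · rintro ⟨m, h, rfl⟩
    simpa using h
  · intro h
    exact ⟨_, h, by simp⟩

/-- Relations, under relational composition and disjoint sum; a bijection is identified with its
graph. -/
def relSystem : PropSystem.{0} where
  Hom I O := I → O → Prop
  ofEquiv e := fun i o => e i = o
  comp R S := Relation.Comp R S
  tens R S := Sum.LiftRel R S
  comp_assoc _ _ _ := Relation.comp_assoc
  refl_comp R := relComp_eq_left (Equiv.refl _) R
  comp_refl R := relComp_eq_right (Equiv.refl _) R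
  ofEquiv_comp e e' := relComp_eq_left e _
  tens_ofEquiv e e' := by
    funext x y
    rcases x with x | x <;> rcases y with y | y <;> simp
  tens_comp f g f' g' := by
    funext x y
    rcases x with x | x <;> rcases y with y | y <;> simp [Relation.Comp]
  tens_assoc f g h := by
    rw [relComp_eq_left, relComp_eq_right]
    funext x y
    rcases x with (x | x) | x <;> rcases y with y | y | y <;> simp
  empty_tens f := by
    rw [relComp_eq_left, relComp_eq_right]
    funext x y
    rcases x with x | x
    · exact x.elim0
    · simp
  tens_empty f := by
    rw [relComp_eq_left, relComp_eq_right]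
    funext x y
    rcases x with x | x
    · simp
    · exact x.elim0
  tens_comm f g := by
    rw [relComp_eq_left, relComp_eq_right]
    funext x y
    rcases x with x | x <;> rcases y with y | y <;> simp

/-- A bijection together with a word over a one-letter alphabet, that is, a natural number, for
every element of the source. -/
@[ext]
structure NodeHom (I O : Type) where
  perm : I ≃ O
  word : I → ℕ

namespace NodeHom

variable {I O M I' O' : Type}

/-- A bijection decorated with empty words. -/
def ofEquiv (e : I ≃ O) : NodeHom I O := ⟨e, fun _ => 0⟩

/-- Composition, in diagrammatic order. -/
def comp (f : NodeHom I M) (g : NodeHom M O) : NodeHom I O :=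
  ⟨f.perm.trans g.perm, fun i => g.word (f.perm i) + f.word i⟩

/-- Juxtaposition. -/
def tens (f : NodeHom I O) (g : NodeHom I' O') : NodeHom (I ⊕ I') (O ⊕ O') :=
  ⟨Equiv.sumCongr f.perm g.perm, Sum.elim f.word g.word⟩

end NodeHom

/-- Bijections decorated with words; words are concatenated along composition. -/
def nodeSystem : PropSystem.{0} where
  Hom I O := NodeHom I O
  ofEquiv e := NodeHom.ofEquiv e
  comp f g := f.comp g
  tens f g := f.tens g
  comp_assoc f g h := NodeHom.ext rfl (funext fun i => (Nat.add_assoc _ _ _).symm)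
  refl_comp f := NodeHom.ext rfl rfl
  comp_refl f := NodeHom.ext rfl (funext fun i => Nat.zero_add _)
  ofEquiv_comp e e' := NodeHom.ext rfl rfl
  tens_ofEquiv e e' := NodeHom.ext rfl (funext fun i => by rcases i with i | i <;> rfl)
  tens_comp f g f' g' := NodeHom.ext (permSystem.tens_comp f.perm g.perm f'.perm g'.perm)
    (funext fun i => by rcases i with i | i <;> rfl)
  tens_assoc f g h := NodeHom.ext (permSystem.tens_assoc f.perm g.perm h.perm)
    (funext fun i => by rcases i with (i | i) | i <;> simp [NodeHom.comp, NodeHom.tens, NodeHom.ofEquiv])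
  empty_tens f := NodeHom.ext (permSystem.empty_tens f.perm)
    (funext fun i => by
      rcases i with i | i
      · exact i.elim0
      · simp [NodeHom.comp, NodeHom.tens, NodeHom.ofEquiv])
  tens_empty f := NodeHom.ext (permSystem.tens_empty f.perm)
    (funext fun i => by
      rcases i with i | i
      · simp [NodeHom.comp, NodeHom.tens, NodeHom.ofEquiv]
      · exact i.elim0)
  tens_comm f g := NodeHom.ext (permSystem.tens_comm f.perm g.perm)
    (funext fun i => by rcases i with i | i <;> simp [NodeHom.comp, NodeHom.tens, NodeHom.ofEquiv])

/-- An interfaced dag with input interface `I`, output interface `O`, and a finite set `N` of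
internal nodes: a relation from `I + N` to `O + N` that is acyclic on `N`. -/
structure IDag (I O : Type) where
  N : Type
  [finite : Finite N]
  R : I ⊕ N → O ⊕ N → Prop
  acyclic : ∀ a : N, ¬ Relation.TransGen (fun b c : N => R (Sum.inr b) (Sum.inr c)) a a

namespace IDag

attribute [instance] IDag.finite

variable {I O M I' O' : Type}

/-- Two dags are isomorphic if they agree up to a bijection of the internal nodes. -/
def IsIso (D D' : IDag I O) : Prop :=
  ∃ σ : D.N ≃ D'.N, ∀ x y, D.R x y ↔ D'.R (Sum.map id σ x) (Sum.map id σ y)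

instance setoid (I O : Type) : Setoid (IDag I O) where
  r := IsIso
  iseqv :=
    { refl := fun D => ⟨Equiv.refl _, fun x y => by simp⟩
      symm := by
        rintro D D' ⟨σ, h⟩
        exact ⟨σ.symm, fun x y => by simp [h]⟩
      trans := by
        rintro D D' D'' ⟨σ, h⟩ ⟨τ, k⟩
        exact ⟨σ.trans τ, fun x y => by simp [h, k, Sum.map_map]⟩ }

variable {N N' N₁ N₂ N₃ N₄ : Type}

/-- The edges of the concatenation of two dags: the composite of the relations
`R + id : (I + N) + N' → (M + N) + N'` and `R' + id : (M + N') + N → (O + N') + N`. -/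
def concatRel (R : I ⊕ N → M ⊕ N → Prop) (R' : M ⊕ N' → O ⊕ N' → Prop) :
    I ⊕ (N ⊕ N') → O ⊕ (N ⊕ N') → Prop
  | .inl i, .inl o => ∃ m, R (.inl i) (.inl m) ∧ R' (.inl m) (.inl o)
  | .inl i, .inr (.inl b) => R (.inl i) (.inr b)
  | .inl i, .inr (.inr b') => ∃ m, R (.inl i) (.inl m) ∧ R' (.inl m) (.inr b')
  | .inr (.inl a), .inl o => ∃ m, R (.inr a) (.inl m) ∧ R' (.inl m) (.inl o)
  | .inr (.inl a), .inr (.inl b) => R (.inr a) (.inr b)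
  | .inr (.inl a), .inr (.inr b') => ∃ m, R (.inr a) (.inl m) ∧ R' (.inl m) (.inr b')
  | .inr (.inr a'), .inl o => R' (.inr a') (.inl o)
  | .inr (.inr _), .inr (.inl _) => False
  | .inr (.inr a'), .inr (.inr b') => R' (.inr a') (.inr b')

/-- The bijection `(I + I') + (N + N') ≅ (I + N) + (I' + N')`. -/
def regroup : (I ⊕ I') ⊕ (N ⊕ N') → (I ⊕ N) ⊕ (I' ⊕ N')
  | .inl (.inl i) => .inl (.inl i)
  | .inl (.inr i') => .inr (.inl i')
  | .inr (.inl a) => .inl (.inr a)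
  | .inr (.inr a') => .inr (.inr a')

/-- The edges of the juxtaposition of two dags: the sum of the relations. -/
def juxtRel (R : I ⊕ N → O ⊕ N → Prop) (R' : I' ⊕ N' → O' ⊕ N' → Prop) :
    (I ⊕ I') ⊕ (N ⊕ N') → (O ⊕ O') ⊕ (N ⊕ N') → Prop :=
  fun x y => Sum.LiftRel R R' (regroup x) (regroup y)

/-- Acyclicity of a relation on a sum without edges from the second summand to the first. -/
theorem acyclic_sum {A B : Type} {r : A ⊕ B → A ⊕ B → Prop}
    (hA : ∀ a, ¬ Relation.TransGen (fun b c => r (.inl b) (.inl c)) a a)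
    (hB : ∀ a, ¬ Relation.TransGen (fun b c => r (.inr b) (.inr c)) a a)
    (hBA : ∀ b a, ¬ r (.inr b) (.inl a)) (x : A ⊕ B) : ¬ Relation.TransGen r x x := by
  have key : ∀ x y, Relation.TransGen r x y →
      match x, y with
      | .inl a, .inl b => Relation.TransGen (fun b c => r (.inl b) (.inl c)) a b
      | .inr a, .inr b => Relation.TransGen (fun b c => r (.inr b) (.inr c)) a b
      | .inr _, .inl _ => False
      | .inl _, .inr _ => True := by
    intro x y h
    induction h with
    | @single y h =>
      rcases x with x | x <;> rcases y with y | y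
      · exact .single h
      · trivial
      · exact hBA _ _ h
      · exact .single h
    | @tail y z _ h ih =>
      rcases x with x | x <;> rcases y with y | y <;> rcases z with z | z
      · exact .tail ih h
      · trivial
      · exact (hBA _ _ h).elim
      · trivial
      · exact ih.elim
      · exact ih.elim
      · exact hBA _ _ h
      · exact .tail ih h
  intro h
  rcases x with x | x
  · exact hA x (key _ _ h)
  · exact hB x (key _ _ h)

/-- Concatenation, in diagrammatic order. -/
def concat (D : IDag I M) (D' : IDag M O) : IDag I O where
  N := D.N ⊕ D'.N
  R := concatRel D.R D'.R
  acyclic := acyclic_sum D.acyclic D'.acyclic fun _ _ h => h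

/-- Juxtaposition. -/
def juxt (D : IDag I O) (D' : IDag I' O') : IDag (I ⊕ I') (O ⊕ O') where
  N := D.N ⊕ D'.N
  R := juxtRel D.R D'.R
  acyclic := acyclic_sum
    (fun a h => D.acyclic a (by simpa [juxtRel, regroup] using h))
    (fun a h => D'.acyclic a (by simpa [juxtRel, regroup] using h))
    (fun b a h => by simp [juxtRel, regroup] at h)

/-- The edge relation without internal nodes of a relation. -/
def pureRel (R : I → O → Prop) : I ⊕ Empty → O ⊕ Empty → Prop
  | .inl i, .inl o => R i o
  | _, _ => False

/-- A relation, viewed as a dag without internal nodes. -/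
def ofRel (R : I → O → Prop) : IDag I O where
  N := Empty
  R := pureRel R
  acyclic a := a.elim

/-- Two edge relations agree up to a bijection of the internal nodes. -/
def RelIso (σ : N ≃ N') (R : I ⊕ N → O ⊕ N → Prop) (R' : I ⊕ N' → O ⊕ N' → Prop) : Prop :=
  ∀ x y, R x y ↔ R' (Sum.map id σ x) (Sum.map id σ y)

theorem concatRel_congr {R : I ⊕ N₁ → M ⊕ N₁ → Prop} {R' : I ⊕ N₂ → M ⊕ N₂ → Prop}
    {S : M ⊕ N₃ → O ⊕ N₃ → Prop} {S' : M ⊕ N₄ → O ⊕ N₄ → Prop} {σ : N₁ ≃ N₂} {τ : N₃ ≃ N₄}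
    (h : RelIso σ R R') (k : RelIso τ S S') :
    RelIso (Equiv.sumCongr σ τ) (concatRel R S) (concatRel R' S') := by
  rintro (x | x | x) (y | y | y) <;> simp [concatRel, h _ _, k _ _]

theorem juxtRel_congr {R : I ⊕ N₁ → O ⊕ N₁ → Prop} {R' : I ⊕ N₂ → O ⊕ N₂ → Prop}
    {S : I' ⊕ N₃ → O' ⊕ N₃ → Prop} {S' : I' ⊕ N₄ → O' ⊕ N₄ → Prop} {σ : N₁ ≃ N₂} {τ : N₃ ≃ N₄}
    (h : RelIso σ R R') (k : RelIso τ S S') :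
    RelIso (Equiv.sumCongr σ τ) (juxtRel R S) (juxtRel R' S') := by
  rintro ((x | x) | x | x) ((y | y) | y | y) <;> simp [juxtRel, regroup, h _ _, k _ _]

theorem concatRel_assoc {M' : Type} (R : I ⊕ N₁ → M ⊕ N₁ → Prop) (S : M ⊕ N₂ → M' ⊕ N₂ → Prop)
    (T : M' ⊕ N₃ → O ⊕ N₃ → Prop) :
    RelIso (Equiv.sumAssoc N₁ N₂ N₃) (concatRel (concatRel R S) T)
      (concatRel R (concatRel S T)) := by
  rintro (x | (x | x) | x) (y | (y | y) | y) <;> simp [concatRel] <;> grind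

theorem pureRel_concatRel (e : I ≃ M) (R : M ⊕ N → O ⊕ N → Prop) :
    RelIso (Equiv.emptySum Empty N) (concatRel (pureRel fun i m => e i = m) R)
      (fun x y => R (Sum.map e id x) y) := by
  rintro (x | x | x) (y | y | y)
  all_goals first | exact x.elim | exact y.elim | simp [concatRel, pureRel]

theorem concatRel_pureRel (e : M ≃ O) (R : I ⊕ N → M ⊕ N → Prop) :
    RelIso (Equiv.sumEmpty N Empty) (concatRel R (pureRel fun i m => e i = m))
      (fun x y => R x (Sum.map e.symm id y)) := by
  rintro (x | x | x) (y | y | y)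
  all_goals first
    | exact x.elim
    | exact y.elim
    | simp [concatRel, pureRel, ← Equiv.eq_symm_apply]

theorem pureRel_concatRel_pureRel (R : I → M → Prop) (S : M → O → Prop) :
    RelIso (Equiv.emptySum Empty Empty) (concatRel (pureRel R) (pureRel S))
      (pureRel (Relation.Comp R S)) := by
  rintro (x | x | x) (y | y | y)
  all_goals first | exact x.elim | exact y.elim | simp [concatRel, pureRel, Relation.Comp]

theorem pureRel_juxtRel_pureRel (R : I → O → Prop) (S : I' → O' → Prop) :
    RelIso (Equiv.emptySum Empty Empty) (juxtRel (pureRel R) (pureRel S))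
      (pureRel (Sum.LiftRel R S)) := by
  rintro ((x | x) | x | x) ((y | y) | y | y)
  all_goals first | exact x.elim | exact y.elim | simp [juxtRel, regroup, pureRel]

theorem juxtRel_concatRel {M' : Type} (R : I ⊕ N₁ → M ⊕ N₁ → Prop) (S : M ⊕ N₂ → O ⊕ N₂ → Prop)
    (R' : I' ⊕ N₃ → M' ⊕ N₃ → Prop) (S' : M' ⊕ N₄ → O' ⊕ N₄ → Prop) :
    RelIso (Equiv.sumSumSumComm N₁ N₃ N₂ N₄) (concatRel (juxtRel R R') (juxtRel S S'))
      (juxtRel (concatRel R S) (concatRel R' S')) := by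
  rintro ((x | x) | (x | x) | x | x) ((y | y) | (y | y) | y | y) <;>
    simp [concatRel, juxtRel, regroup]

theorem juxtRel_assoc {I'' O'' : Type} (R : I ⊕ N₁ → O ⊕ N₁ → Prop)
    (S : I' ⊕ N₂ → O' ⊕ N₂ → Prop) (T : I'' ⊕ N₃ → O'' ⊕ N₃ → Prop) :
    RelIso (Equiv.sumAssoc N₁ N₂ N₃)
      (fun x y => juxtRel (juxtRel R S) T x (Sum.map (Equiv.sumAssoc O O' O'').symm id y))
      (fun x y => juxtRel R (juxtRel S T) (Sum.map (Equiv.sumAssoc I I' I'') id x) y) := by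
  rintro (((x | x) | x) | (x | x) | x) ((y | y | y) | (y | y) | y) <;> simp [juxtRel, regroup]

theorem juxtRel_comm (R : I ⊕ N₁ → O ⊕ N₁ → Prop) (S : I' ⊕ N₂ → O' ⊕ N₂ → Prop) :
    RelIso (Equiv.sumComm N₁ N₂)
      (fun x y => juxtRel R S x (Sum.map (Equiv.sumComm O O').symm id y))
      (fun x y => juxtRel S R (Sum.map (Equiv.sumComm I I') id x) y) := by
  rintro ((x | x) | x | x) ((y | y) | y | y) <;> simp [juxtRel, regroup]

theorem pureRel_juxtRel (R : I ⊕ N → O ⊕ N → Prop) (Z : Fin 0 → Fin 0 → Prop) :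
    RelIso (Equiv.emptySum Empty N)
      (fun x y => juxtRel (pureRel Z) R x (Sum.map (Equiv.emptySum (Fin 0) O).symm id y))
      (fun x y => R (Sum.map (Equiv.emptySum (Fin 0) I) id x) y) := by
  rintro ((x | x) | x | x) (y | y | y)
  all_goals first
    | exact x.elim0
    | exact x.elim
    | exact y.elim
    | simp [juxtRel, regroup]

theorem juxtRel_pureRel (R : I ⊕ N → O ⊕ N → Prop) (Z : Fin 0 → Fin 0 → Prop) :
    RelIso (Equiv.sumEmpty N Empty)
      (fun x y => juxtRel R (pureRel Z) x (Sum.map (Equiv.sumEmpty O (Fin 0)).symm id y))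
      (fun x y => R (Sum.map (Equiv.sumEmpty I (Fin 0)) id x) y) := by
  rintro ((x | x) | x | x) (y | y | y)
  all_goals first
    | exact x.elim0
    | exact x.elim
    | exact y.elim
    | simp [juxtRel, regroup]

end IDag

/-- Abstract dags: isomorphism classes of dags. -/
def AbstractDag (I O : Type) : Type 1 := Quotient (IDag.setoid I O)

namespace AbstractDag

variable {I O M I' O' : Type}

/-- The class of a dag. -/
def mk (D : IDag I O) : AbstractDag I O := Quotient.mk _ D

/-- Concatenation of abstract dags. -/
def concat : AbstractDag I M → AbstractDag M O → AbstractDag I O :=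
  Quotient.map₂ IDag.concat (by
    rintro D E ⟨σ, h⟩ D' E' ⟨τ, k⟩
    exact ⟨Equiv.sumCongr σ τ, IDag.concatRel_congr h k⟩)

/-- Juxtaposition of abstract dags. -/
def juxt : AbstractDag I O → AbstractDag I' O' → AbstractDag (I ⊕ I') (O ⊕ O') :=
  Quotient.map₂ IDag.juxt (by
    rintro D E ⟨σ, h⟩ D' E' ⟨τ, k⟩
    exact ⟨Equiv.sumCongr σ τ, IDag.juxtRel_congr h k⟩)

/-- The abstract dag of a relation. -/
def ofRel (R : I → O → Prop) : AbstractDag I O := mk (IDag.ofRel R)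

theorem sound {D D' : IDag I O} (σ : D.N ≃ D'.N) (h : IDag.RelIso σ D.R D'.R) : mk D = mk D' :=
  Quotient.sound ⟨σ, h⟩

theorem concat_mk (D : IDag I M) (D' : IDag M O) : concat (mk D) (mk D') = mk (D.concat D') := rfl

theorem juxt_mk (D : IDag I O) (D' : IDag I' O') : juxt (mk D) (mk D') = mk (D.juxt D') := rfl

theorem mk_surj (D : AbstractDag I O) : ∃ D₀, D = mk D₀ :=
  ⟨D.out, (Quotient.out_eq _).symm⟩

theorem ofRel_concat_ofRel (R : I → M → Prop) (S : M → O → Prop) :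
    concat (ofRel R) (ofRel S) = ofRel (Relation.Comp R S) :=
  sound _ (IDag.pureRel_concatRel_pureRel R S)

theorem ofRel_juxt_ofRel (R : I → O → Prop) (S : I' → O' → Prop) :
    juxt (ofRel R) (ofRel S) = ofRel (Sum.LiftRel R S) :=
  sound _ (IDag.pureRel_juxtRel_pureRel R S)

theorem equiv_concat (e : I ≃ M) (D : IDag M O) :
    concat (ofRel fun i m => e i = m) (mk D) =
      mk ⟨D.N, fun x y => D.R (Sum.map e id x) y, D.acyclic⟩ :=
  sound _ (IDag.pureRel_concatRel e D.R)

theorem concat_equiv (e : M ≃ O) (D : IDag I M) :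
    concat (mk D) (ofRel fun i m => e i = m) =
      mk ⟨D.N, fun x y => D.R x (Sum.map e.symm id y), D.acyclic⟩ :=
  sound _ (IDag.concatRel_pureRel e D.R)

end AbstractDag

/-- Abstract dags, under concatenation and juxtaposition. -/
def dagSystem : PropSystem.{1} where
  Hom I O := AbstractDag I O
  ofEquiv e := AbstractDag.ofRel fun i o => e i = o
  comp f g := f.concat g
  tens f g := f.juxt g
  comp_assoc f g h := by
    obtain ⟨f, rfl⟩ := f.mk_surj
    obtain ⟨g, rfl⟩ := g.mk_surj
    obtain ⟨h, rfl⟩ := h.mk_surj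
    exact AbstractDag.sound _ (IDag.concatRel_assoc f.R g.R h.R)
  refl_comp f := by
    obtain ⟨f, rfl⟩ := f.mk_surj
    rw [AbstractDag.equiv_concat]
    exact AbstractDag.sound (Equiv.refl _) fun x y => by simp
  comp_refl f := by
    obtain ⟨f, rfl⟩ := f.mk_surj
    rw [AbstractDag.concat_equiv]
    exact AbstractDag.sound (Equiv.refl _) fun x y => by simp
  ofEquiv_comp e e' := by
    rw [AbstractDag.ofRel_concat_ofRel]
    exact congrArg AbstractDag.ofRel (relSystem.ofEquiv_comp e e')
  tens_ofEquiv e e' := by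
    rw [AbstractDag.ofRel_juxt_ofRel]
    exact congrArg AbstractDag.ofRel (relSystem.tens_ofEquiv e e')
  tens_comp f g f' g' := by
    obtain ⟨f, rfl⟩ := f.mk_surj
    obtain ⟨g, rfl⟩ := g.mk_surj
    obtain ⟨f', rfl⟩ := f'.mk_surj
    obtain ⟨g', rfl⟩ := g'.mk_surj
    exact AbstractDag.sound _ (IDag.juxtRel_concatRel f.R g.R f'.R g'.R)
  tens_assoc f g h := by
    obtain ⟨f, rfl⟩ := f.mk_surj
    obtain ⟨g, rfl⟩ := g.mk_surj
    obtain ⟨h, rfl⟩ := h.mk_surj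
    simp only [AbstractDag.juxt_mk]
    rw [AbstractDag.equiv_concat, AbstractDag.concat_equiv]
    exact AbstractDag.sound _ (IDag.juxtRel_assoc f.R g.R h.R)
  empty_tens f := by
    obtain ⟨f, rfl⟩ := f.mk_surj
    rw [AbstractDag.ofRel, AbstractDag.juxt_mk, AbstractDag.equiv_concat,
      AbstractDag.concat_equiv]
    exact AbstractDag.sound _ (IDag.pureRel_juxtRel f.R _)
  tens_empty f := by
    obtain ⟨f, rfl⟩ := f.mk_surj
    rw [AbstractDag.ofRel, AbstractDag.juxt_mk, AbstractDag.equiv_concat,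
      AbstractDag.concat_equiv]
    exact AbstractDag.sound _ (IDag.juxtRel_pureRel f.R _)
  tens_comm f g := by
    obtain ⟨f, rfl⟩ := f.mk_surj
    obtain ⟨g, rfl⟩ := g.mk_surj
    simp only [AbstractDag.juxt_mk]
    rw [AbstractDag.equiv_concat, AbstractDag.concat_equiv]
    exact AbstractDag.sound _ (IDag.juxtRel_comm f.R g.R)

namespace NodeHom

variable {I O M I' O' : Type}

/-- The nodes of the dag of a decorated bijection: the word at `i` contributes a chain of
`word i` nodes `(i, 0), (i, 1), …`. -/
def Chain (f : NodeHom I O) : Type := {p : I × ℕ // p.2 < f.word p.1}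

instance [Finite I] (f : NodeHom I O) : Finite f.Chain :=
  Finite.of_injective (β := Σ i, Fin (f.word i)) (fun p => ⟨p.1.1, ⟨p.1.2, p.2⟩⟩) (by
    rintro ⟨⟨i, a⟩, h⟩ ⟨⟨j, b⟩, k⟩ e
    simp only [Sigma.mk.injEq] at e
    obtain ⟨rfl, e⟩ := e
    simp only [heq_eq_eq, Fin.mk.injEq] at e
    subst e
    rfl)

/-- The gap of a strand from which a vertex emits its edge: an input is followed by gap `0`, and
the node `(i, a)` by gap `a + 1`. -/
def outGap (f : NodeHom I O) : I ⊕ f.Chain → I × ℕ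
  | .inl i => (i, 0)
  | .inr p => (p.1.1, p.1.2 + 1)

/-- The gap of a strand from which a vertex receives its edge: the node `(i, a)` is preceded by
gap `a`, and the output at the end of strand `i` by gap `word i`. -/
def inGap (f : NodeHom I O) : O ⊕ f.Chain → I × ℕ
  | .inl o => (f.perm.symm o, f.word (f.perm.symm o))
  | .inr p => p.1

/-- The edges join consecutive vertices of a strand. -/
def strandRel (f : NodeHom I O) (x : I ⊕ f.Chain) (y : O ⊕ f.Chain) : Prop :=
  f.outGap x = f.inGap y

/-- The dag of a decorated bijection: a strand from every input `i` through its `word i` nodes to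
the output `perm i`. -/
def toDag [Finite I] (f : NodeHom I O) : IDag I O where
  N := f.Chain
  R := f.strandRel
  acyclic a h := by
    have key : ∀ a b : f.Chain, Relation.TransGen
        (fun b c : f.Chain => f.strandRel (.inr b) (.inr c)) a b → a.1.2 < b.1.2 := by
      intro a b h
      induction h with
      | single h => exact Nat.lt_of_succ_le (congrArg Prod.snd h).le
      | tail _ h ih => exact ih.trans (Nat.lt_of_succ_le (congrArg Prod.snd h).le)
    exact lt_irrefl _ (key a a h)

/-- The nodes of a composite are those of the two factors. -/
def chainComp (f : NodeHom I M) (g : NodeHom M O) :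
    f.Chain ⊕ g.Chain → (f.comp g).Chain
  | .inl p => ⟨p.1, Nat.lt_of_lt_of_le p.2 (Nat.le_add_left _ _)⟩
  | .inr q => ⟨(f.perm.symm q.1.1, f.word (f.perm.symm q.1.1) + q.1.2), by
      have := q.2
      simp only [comp, Equiv.apply_symm_apply]
      omega⟩

theorem chainComp_bijective (f : NodeHom I M) (g : NodeHom M O) :
    Function.Bijective (chainComp f g) := by
  constructor
  · rintro (⟨⟨i, a⟩, h⟩ | ⟨⟨i, a⟩, h⟩) (⟨⟨j, b⟩, k⟩ | ⟨⟨j, b⟩, k⟩) e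
    all_goals
      have e₁ := congrArg (fun p => p.1.1) e
      have e₂ := congrArg (fun p => p.1.2) e
      clear e
      simp only [chainComp] at e₁ e₂ h k
    · subst e₁ e₂; rfl
    · subst e₁; omega
    · subst e₁; omega
    · have e₁ := f.perm.symm.injective e₁
      subst e₁
      have e₂ : a = b := by omega
      subst e₂
      rfl
  · rintro ⟨⟨i, a⟩, h⟩
    by_cases ha : a < f.word i
    · exact ⟨.inl ⟨(i, a), ha⟩, rfl⟩
    · refine ⟨.inr ⟨(f.perm i, a - f.word i), ?_⟩, Subtype.ext ?_⟩
      · simp only [comp] at h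
        simp only
        omega
      · simp only [chainComp, Equiv.symm_apply_apply, Prod.mk.injEq, true_and]
        omega

theorem strandRel_comp (f : NodeHom I M) (g : NodeHom M O) :
    IDag.RelIso (Equiv.ofBijective _ (chainComp_bijective f g))
      (IDag.concatRel f.strandRel g.strandRel) (f.comp g).strandRel := by
  intro x y
  change _ ↔ (f.comp g).strandRel (Sum.map id (chainComp f g) x) (Sum.map id (chainComp f g) y)
  rcases x with x | x | x <;> rcases y with y | y | y
  all_goals
    simp only [IDag.concatRel, strandRel, Sum.map_inl, Sum.map_inr, id, outGap, inGap, chainComp]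
    try simp only [comp, Prod.ext_iff, Equiv.symm_trans_apply, Equiv.apply_symm_apply,
      EmbeddingLike.apply_eq_iff_eq]
    try have hx := x.2
    try have hy := y.2
    try grind

/-- The nodes of a juxtaposition are those of the two parts. -/
def chainTens (f : NodeHom I O) (g : NodeHom I' O') : f.Chain ⊕ g.Chain → (f.tens g).Chain
  | .inl p => ⟨(.inl p.1.1, p.1.2), p.2⟩
  | .inr q => ⟨(.inr q.1.1, q.1.2), q.2⟩

theorem chainTens_bijective (f : NodeHom I O) (g : NodeHom I' O') :
    Function.Bijective (chainTens f g) := by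
  constructor
  · rintro (⟨⟨i, a⟩, h⟩ | ⟨⟨i, a⟩, h⟩) (⟨⟨j, b⟩, k⟩ | ⟨⟨j, b⟩, k⟩) e
    all_goals
      have e₁ := congrArg (fun p => p.1.1) e
      have e₂ := congrArg (fun p => p.1.2) e
      clear e
      simp only [chainTens, Sum.inl.injEq, Sum.inr.injEq, reduceCtorEq] at e₁ e₂
    · subst e₁ e₂; rfl
    · subst e₁ e₂; rfl
  · rintro ⟨⟨i | i, a⟩, h⟩
    · exact ⟨.inl ⟨(i, a), h⟩, rfl⟩
    · exact ⟨.inr ⟨(i, a), h⟩, rfl⟩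

theorem strandRel_tens (f : NodeHom I O) (g : NodeHom I' O') :
    IDag.RelIso (Equiv.ofBijective _ (chainTens_bijective f g))
      (IDag.juxtRel f.strandRel g.strandRel) (f.tens g).strandRel := by
  intro x y
  change _ ↔ (f.tens g).strandRel (Sum.map id (chainTens f g) x) (Sum.map id (chainTens f g) y)
  rcases x with (x | x) | x | x <;> rcases y with (y | y) | y | y <;>
    simp only [IDag.juxtRel, IDag.regroup, strandRel, Sum.map_inl, Sum.map_inr, id, outGap, inGap,
      chainTens, Sum.liftRel_inl_inl, Sum.liftRel_inr_inr, Sum.not_liftRel_inl_inr,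
      Sum.not_liftRel_inr_inl] <;>
    simp [tens, Prod.ext_iff]

theorem strandRel_ofEquiv (e : I ≃ O) :
    IDag.RelIso (N := (ofEquiv e).Chain) (N' := Empty)
      { toFun := fun p => (Nat.not_lt_zero _ p.2).elim
        invFun := Empty.elim
        left_inv := fun p => (Nat.not_lt_zero _ p.2).elim
        right_inv := fun p => p.elim }
      (ofEquiv e).strandRel (IDag.pureRel fun i o => e i = o) := by
  rintro (x | x) (y | y)
  · simp [strandRel, outGap, inGap, ofEquiv, IDag.pureRel, Equiv.eq_symm_apply]
  · exact (Nat.not_lt_zero _ y.2).elim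
  · exact (Nat.not_lt_zero _ x.2).elim
  · exact (Nat.not_lt_zero _ x.2).elim

end NodeHom

/-- A bijection as its graph. -/
def permToRel : PropMap permSystem relSystem where
  map e := relSystem.ofEquiv e
  map_ofEquiv _ := rfl
  map_comp e e' := (relSystem.ofEquiv_comp e e').symm
  map_tens e e' := (relSystem.tens_ofEquiv e e').symm

/-- A bijection decorated with empty words. -/
def permToNode : PropMap permSystem nodeSystem where
  map e := nodeSystem.ofEquiv e
  map_ofEquiv _ := rfl
  map_comp e e' := (nodeSystem.ofEquiv_comp e e').symm
  map_tens e e' := (nodeSystem.tens_ofEquiv e e').symm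

/-- A relation as a dag without internal nodes. -/
def relToDag : PropMap relSystem dagSystem where
  map R := AbstractDag.ofRel R
  map_ofEquiv _ := rfl
  map_comp R S := (AbstractDag.ofRel_concat_ofRel R S).symm
  map_tens R S := (AbstractDag.ofRel_juxt_ofRel R S).symm

/-- A decorated bijection as the dag of its strands. -/
def nodeToDag : PropMap nodeSystem dagSystem where
  map f := AbstractDag.mk (NodeHom.toDag f)
  map_ofEquiv e := AbstractDag.sound _ (NodeHom.strandRel_ofEquiv e)
  map_comp f g := (AbstractDag.sound _ (NodeHom.strandRel_comp f g)).symm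
  map_tens f g := (AbstractDag.sound _ (NodeHom.strandRel_tens f g)).symm

/-- The PROP of finite ordinals and bijections. -/
abbrev PermProp : Type := permSystem.Cat

/-- The PROP of finite ordinals and relations. -/
abbrev RelProp : Type := relSystem.Cat

/-- The PROP of a node: morphisms `n ⟶ m` are bijections decorated with words in one letter. -/
abbrev NodeProp : Type := nodeSystem.Cat

/-- The PROP of finite abstract dags. -/
abbrev DagProp : Type := dagSystem.Cat

/-- The generating node `1 ⟶ 1`: the identity decorated with the one-letter word. -/
def nodeGen : (⟨1⟩ : NodeProp) ⟶ ⟨1⟩ := (⟨Equiv.refl (Fin 1), fun _ => 1⟩ : NodeHom _ _)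

/-- The dag with one input, one output and one internal node, and with edges from the input to the
node and from the node to the output. -/
def singleNode : IDag (Fin 1) (Fin 1) where
  N := Unit
  R
    | .inl _, .inr _ => True
    | .inr _, .inl _ => True
    | _, _ => False
  acyclic a h := by
    cases h with
    | single h => exact h
    | tail _ h => exact h

/-- The class of a dag as a morphism of `DagProp`. -/
def IDag.toHom {n m : ℕ} (D : IDag (Fin n) (Fin m)) : (⟨n⟩ : DagProp) ⟶ ⟨m⟩ :=
  AbstractDag.mk D

/-! ### Interpretation of dags -/

/-- A topological sorting of a finite dag. -/
structure IDag.TopSort {I O : Type} (D : IDag I O) where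
  toEquiv : Fin (Nat.card D.N) ≃ D.N
  lt_of_edge : ∀ i j, D.R (Sum.inr (toEquiv i)) (Sum.inr (toEquiv j)) → i < j

namespace IDag.TopSort

variable {n m : ℕ} {D : IDag (Fin n) (Fin m)} (σ : D.TopSort)

/-- The vertex of `D` at position `x` of `n + k`: the inputs, followed by the first `k` nodes. -/
noncomputable def vertex (k : ℕ) (hk : k ≤ Nat.card D.N) (x : Fin (n + k)) : Fin n ⊕ D.N :=
  Sum.map id (fun l : Fin k => σ.toEquiv (Fin.castLE hk l)) (finSumFinEquiv.symm x)

/-- The relation `n + k → n + k + 1` that is the inclusion together with the edges from the inputs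
and the first `k` nodes to the node number `k`. -/
noncomputable def stepRel (k : ℕ) (hk : k < Nat.card D.N) : (⟨n + k⟩ : RelProp) ⟶ ⟨n + k + 1⟩ :=
  fun (x : Fin (n + k)) (y : Fin (n + k + 1)) =>
    y = Fin.castSucc x ∨
      (y = Fin.last (n + k) ∧ D.R (σ.vertex k hk.le x) (Sum.inr (σ.toEquiv ⟨k, hk⟩)))

/-- The relation `n + |N| → m` of the edges from the inputs and the nodes to the outputs. -/
noncomputable def lastRel : (⟨n + Nat.card D.N⟩ : RelProp) ⟶ ⟨m⟩ :=
  fun (x : Fin (n + Nat.card D.N)) (y : Fin m) => D.R (σ.vertex _ le_rfl x) (Sum.inl y)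

end IDag.TopSort

section Interpretation

variable {C : Type u} [Category.{v} C] [MonoidalCategory C] [SymmetricCategory C]

/-- Tensor powers `A ⊗ ⋯ ⊗ A`, bracketed to the left. -/
def tensorPow (A : C) : ℕ → C
  | 0 => 𝟙_ C
  | n + 1 => tensorPow A n ⊗ A

/-- The canonical isomorphism `A ⊗ ⋯ ⊗ A ≅ F n` for `A = F 1`. -/
def powIso {P : PropSystem.{w}} (F : SymMonFunctor P.Cat C) :
    ∀ n : ℕ, tensorPow (F.functor.obj ⟨1⟩) n ≅ F.functor.obj ⟨n⟩
  | 0 => Functor.Monoidal.εIso F.functor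
  | n + 1 => whiskerRightIso (powIso F n) (F.functor.obj ⟨1⟩) ≪≫
      Functor.Monoidal.μIso F.functor ⟨n⟩ ⟨1⟩

/-- The interpretation `A ⊗ ⋯ ⊗ A ⟶ A ⊗ ⋯ ⊗ A` of a relation in the degenerate commutative
bialgebra `A = F 1`. -/
def semRel (F : SymMonFunctor RelProp C) {a b : ℕ} (R : (⟨a⟩ : RelProp) ⟶ ⟨b⟩) :
    tensorPow (F.functor.obj ⟨1⟩) a ⟶ tensorPow (F.functor.obj ⟨1⟩) b :=
  (powIso F a).hom ≫ F.functor.map R ≫ (powIso F b).inv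

variable (F : SymMonFunctor RelProp C) (lam : F.functor.obj ⟨1⟩ ⟶ F.functor.obj ⟨1⟩)
  {n m : ℕ} {D : IDag (Fin n) (Fin m)} (σ : D.TopSort)

/-- The first `k` stages of the interpretation of a dag sorted by `σ`: at every stage interpret the
relation `stepRel`, then apply the node to the last factor. -/
noncomputable def semStage : ∀ k : ℕ, k ≤ Nat.card D.N →
    (tensorPow (F.functor.obj ⟨1⟩) n ⟶ tensorPow (F.functor.obj ⟨1⟩) (n + k))
  | 0, _ => 𝟙 _
  | k + 1, hk => semStage k (Nat.le_of_succ_le hk) ≫ semRel F (σ.stepRel k hk) ≫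
      (tensorPow (F.functor.obj ⟨1⟩) (n + k) ◁ lam)

/-- The interpretation of a dag sorted by `σ`. -/
noncomputable def semDag : tensorPow (F.functor.obj ⟨1⟩) n ⟶ tensorPow (F.functor.obj ⟨1⟩) m :=
  semStage F lam σ (Nat.card D.N) le_rfl ≫ semRel F σ.lastRel

/-- Two functors on `RelProp` and `NodeProp` that agree on `PermProp` agree on objects. -/
theorem cone_obj_eq {F : SymMonFunctor RelProp C} {H : SymMonFunctor NodeProp C}
    (h : permToRel.toSymMon.comp F = permToNode.toSymMon.comp H) (n : ℕ) :
    F.functor.obj ⟨n⟩ = H.functor.obj ⟨n⟩ :=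
  SymMonFunctor.obj_eq h ⟨n⟩

/-- The node `A ⟶ A` on `A = F 1 = H 1` given by a cone. -/
def coneNode {F : SymMonFunctor RelProp C} {H : SymMonFunctor NodeProp C}
    (h : permToRel.toSymMon.comp F = permToNode.toSymMon.comp H) :
    F.functor.obj ⟨1⟩ ⟶ F.functor.obj ⟨1⟩ :=
  eqToHom (cone_obj_eq h 1) ≫ H.functor.map nodeGen ≫ eqToHom (cone_obj_eq h 1).symm

/-- A mediating functor agrees with the given functor on objects. -/
theorem mediating_obj_eq {F : SymMonFunctor RelProp C} {K : SymMonFunctor DagProp C}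
    (h : relToDag.toSymMon.comp K = F) (n : ℕ) : K.functor.obj ⟨n⟩ = F.functor.obj ⟨n⟩ :=
  SymMonFunctor.obj_eq h ⟨n⟩

end Interpretation

/-! A dag `(N, R)` is run like a machine with one register per vertex. Given `F` and a node `lam`,
take the value of `F` at `I ⊕ N` as a fixed state object, with the registers of internal nodes
initialised by the unit of the bialgebra. The node `a` acts by an endomorphism of this object,
`nodeStep`: add copies of the predecessors of `a` to the register `a`, then apply `lam` there. At
the end a relation collects the outputs. Steps at nodes not joined by an edge commute
(`gatherStep_comm`), and the run is unchanged when a topological order is replaced by another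
(`listComp_eq_of_perm`), so the result depends only on the isomorphism class of the dag.

All compatibilities come from one naturality statement, `nodeAt_evalRel`: a relation that joins `a`
to `b` only, and nothing else to `b`, carries `lam` at `a` to `lam` at `b`. Through
`gatherStep_comp` it shows that runs of different dags are intertwined by suitable relations between
their vertices; concatenation (`evalList_concatRel`) and juxtaposition with a relation
(`evalList_juxtRel`) are instances.

The resulting functor takes its structure isomorphisms from `F`. The coherence axioms involve only
structure morphisms that already live in `RelProp`, and so are inherited. Its restriction to
`NodeProp` is `H`, because bijections and the nodes on a last strand generate that PROP
(`NodeHom.fin_induction`).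

For uniqueness and the formula, a sorted dag is factored inside `DagProp` into relations and
whiskered single nodes (`stageHom_comp_lastRel`). Any mediating functor has prescribed values on
these factors; transporting the composite along `powIso` gives the formula. Among the four
embeddings only that of `NodeProp` needs an argument for injectivity: an isomorphism of dags of
strands fixes the coordinates of each node, because it preserves edges starting from the inputs. -/

/-! ### Relations between enumerated sets -/

/-- A set with a chosen enumeration by a finite ordinal. -/
class Enumerated (V : Type) where
  card : ℕ
  equiv : V ≃ Fin card

namespace Enumerated

instance (n : ℕ) : Enumerated (Fin n) := ⟨n, Equiv.refl _⟩

/-- With this choice `relObj (V ⊕ W)` is `relObj V ⊗ relObj W` by definition, so disjoint unions of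
vertex sets can be fed to the structure maps of `F` without transport. -/
instance (V W : Type) [Enumerated V] [Enumerated W] : Enumerated (V ⊕ W) :=
  ⟨card V + card W, (Equiv.sumCongr equiv equiv).trans finSumFinEquiv⟩

/-- An arbitrary enumeration of a finite set. -/
@[reducible]
noncomputable def ofFinite (V : Type) [Finite V] : Enumerated V := ⟨_, Finite.equivFin V⟩

theorem finite (V : Type) [Enumerated V] : Finite V := Finite.of_equiv _ equiv.symm

noncomputable instance (V : Type) [Enumerated V] (a : V) : Enumerated {x : V // x ≠ a} :=
  have := finite V
  ofFinite _

/-- For a concatenation this competes with the enumeration of a sum; `IDag.evalList_congr` shows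
that the choice does not affect the interpretation. -/
noncomputable instance {I O : Type} (D : IDag I O) : Enumerated D.N := ofFinite _

end Enumerated

theorem symm_trans_eq {A B E : Type} {e : A ≃ B} {f : A ≃ E} {g : B ≃ E} (h : f = e.trans g) :
    e.symm.trans f = g := by
  rw [h, ← Equiv.trans_assoc, Equiv.symm_trans_self, Equiv.refl_trans]

section RelHom

variable {V W X V' W' : Type} [Enumerated V'] [Enumerated W'] [Enumerated V] [Enumerated W]
  [Enumerated X]

/-- The object of `RelProp` that enumerates `V`. -/
abbrev relObj (V : Type) [Enumerated V] : RelProp := ⟨Enumerated.card V⟩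

/-- A relation between enumerated sets as a morphism of `RelProp`. -/
def relHom (R : V → W → Prop) : relObj V ⟶ relObj W :=
  fun (x : Fin (Enumerated.card V)) (y : Fin (Enumerated.card W)) =>
    R (Enumerated.equiv.symm x) (Enumerated.equiv.symm y)

theorem relHom_comp (R : V → W → Prop) (S : W → X → Prop) :
    relHom R ≫ relHom S = relHom (Relation.Comp R S) := by
  funext x y
  change (∃ z, _ ∧ _) = ∃ z, _ ∧ _
  exact propext (Enumerated.equiv.symm.exists_congr_left.trans (by simp [relHom]))

theorem relHom_id : relHom (fun x y : V => x = y) = 𝟙 (relObj V) := by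
  funext x y
  change (_ = _) = ((Equiv.refl _) x = y)
  simp

/-- The tensor product of the PROP is conjugation by `finSumFinEquiv`, the same bijection that
enumerates a sum. -/
theorem relHom_liftRel (R : V → W → Prop) (S : V' → W' → Prop) :
    relHom (Sum.LiftRel R S) = relHom R ⊗ₘ relHom S := by
  change _ = Relation.Comp (fun i j => finSumFinEquiv.symm i = j) (Relation.Comp
    (Sum.LiftRel (fun x y => R (Enumerated.equiv.symm x) (Enumerated.equiv.symm y))
      fun x y => S (Enumerated.equiv.symm x) (Enumerated.equiv.symm y))
    (fun i j => finSumFinEquiv i = j))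
  rw [relComp_eq_right, relComp_eq_left]
  funext x y
  obtain ⟨x, rfl⟩ := finSumFinEquiv.surjective x
  obtain ⟨y, rfl⟩ := finSumFinEquiv.surjective y
  change Sum.LiftRel R S ((Equiv.sumCongr _ _).symm (finSumFinEquiv.symm (finSumFinEquiv x)))
    ((Equiv.sumCongr _ _).symm (finSumFinEquiv.symm (finSumFinEquiv y))) = _
  simp only [Equiv.symm_apply_apply]
  rcases x with x | x <;> rcases y with y | y <;> simp

theorem relHom_equiv (e : V ≃ W) :
    relHom (fun x y => e x = y) =
      relSystem.ofEquiv (Enumerated.equiv.symm.trans (e.trans Enumerated.equiv)) := by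
  funext x y
  exact propext (Equiv.eq_symm_apply _)

theorem relHom_sumComm :
    relHom (fun (x : V ⊕ W) y => Equiv.sumComm V W x = y) = (β_ (relObj V) (relObj W)).hom := by
  refine (relHom_equiv _).trans (congrArg relSystem.ofEquiv ?_)
  refine symm_trans_eq ?_
  ext x
  rcases x with x | x
  · exact (congrArg Fin.val (PropSystem.blockSwap_castAdd _ _ (Enumerated.equiv x))).symm
  · exact (congrArg Fin.val (PropSystem.blockSwap_natAdd _ _ (Enumerated.equiv x))).symm

theorem relHom_sumAssoc :
    relHom (fun (x : (V ⊕ W) ⊕ X) y => Equiv.sumAssoc V W X x = y) =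
      (α_ (relObj V) (relObj W) (relObj X)).hom := by
  refine (relHom_equiv _).trans (congrArg relSystem.ofEquiv ?_)
  refine symm_trans_eq ?_
  ext x
  rcases x with (x | x) | x <;>
    simp [Enumerated.equiv, Enumerated.card, Nat.add_assoc]

theorem relHom_emptySum :
    relHom (fun (x : Fin 0 ⊕ V) y => Equiv.emptySum (Fin 0) V x = y) = (λ_ (relObj V)).hom := by
  refine (relHom_equiv _).trans (congrArg relSystem.ofEquiv ?_)
  refine symm_trans_eq ?_
  ext x
  rcases x with x | x
  · exact x.elim0
  · simp [Enumerated.equiv, Enumerated.card]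

end RelHom

/-! ### Associators and unitors under a strong monoidal functor -/

section MonoidalFunctor

open Functor.OplaxMonoidal Functor.LaxMonoidal

variable {D : Type u₁} [Category.{v₁} D] [MonoidalCategory D] {C : Type u} [Category.{v} C]
  [MonoidalCategory C] (F : D ⥤ C) [F.Monoidal]

/-- The morphisms need not be in the image of `F`, so functoriality does not suffice. Once `δ` and
`μ` are pulled out of the tensor products, the associator passes `μ` by associativity, the middle by
naturality, and `δ` by coassociativity. -/
theorem tensorHom_comp_map_associator {X Y Z X' Y' Z' : D} (f : F.obj X ⟶ F.obj X')
    (g : F.obj Y ⟶ F.obj Y') (h : F.obj Z ⟶ F.obj Z') :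
    (δ F (X ⊗ Y) Z ≫ ((δ F X Y ≫ (f ⊗ₘ g) ≫ μ F X' Y') ⊗ₘ h) ≫ μ F (X' ⊗ Y') Z') ≫
        F.map (α_ X' Y' Z').hom =
      F.map (α_ X Y Z).hom ≫
        δ F X (Y ⊗ Z) ≫ (f ⊗ₘ (δ F Y Z ≫ (g ⊗ₘ h) ≫ μ F Y' Z')) ≫ μ F X' (Y' ⊗ Z') := by
  have hl : (δ F X Y ≫ (f ⊗ₘ g) ≫ μ F X' Y') ⊗ₘ h =
      δ F X Y ▷ F.obj Z ≫ ((f ⊗ₘ g) ⊗ₘ h) ≫ μ F X' Y' ▷ F.obj Z' := by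
    simp only [← tensorHom_id, tensorHom_comp_tensorHom, Category.comp_id, Category.id_comp]
  have hr : f ⊗ₘ (δ F Y Z ≫ (g ⊗ₘ h) ≫ μ F Y' Z') =
      F.obj X ◁ δ F Y Z ≫ (f ⊗ₘ (g ⊗ₘ h)) ≫ F.obj X' ◁ μ F Y' Z' := by
    simp only [← id_tensorHom, tensorHom_comp_tensorHom, Category.comp_id, Category.id_comp]
  rw [hl, hr]
  simp only [Category.assoc]
  rw [Functor.LaxMonoidal.associativity, associator_naturality_assoc,
    Functor.OplaxMonoidal.associativity_assoc]

theorem id_tensorHom_comp_map_leftUnitor {X Y : D} (f : F.obj X ⟶ F.obj Y) :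
    (δ F (𝟙_ D) X ≫ (𝟙 (F.obj (𝟙_ D)) ⊗ₘ f) ≫ μ F (𝟙_ D) Y) ≫ F.map (λ_ Y).hom =
      F.map (λ_ X).hom ≫ f := by
  rw [Functor.Monoidal.map_leftUnitor, Functor.Monoidal.map_leftUnitor]
  simp only [id_tensorHom, Category.assoc, Functor.Monoidal.μ_δ_assoc]
  rw [whisker_exchange_assoc]
  simp

end MonoidalFunctor

/-! ### The functor on enumerated sets, and the node placed at an element -/

section Extension

variable {C : Type u} [Category.{v} C] [MonoidalCategory C] [SymmetricCategory C]
  (F : SymMonFunctor RelProp C)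
  {V W X V' W' X' : Type} [Enumerated V'] [Enumerated W'] [Enumerated X'] [Enumerated V]
  [Enumerated W] [Enumerated X]

/-- The value of `F` at an enumerated set. -/
abbrev evalObj (V : Type) [Enumerated V] : C := F.functor.obj (relObj V)

/-- The value of `F` at a relation between enumerated sets. -/
def evalRel (R : V → W → Prop) : evalObj F V ⟶ evalObj F W := F.functor.map (relHom R)

theorem evalRel_comp (R : V → W → Prop) (S : W → X → Prop) :
    evalRel F R ≫ evalRel F S = evalRel F (Relation.Comp R S) := by
  rw [evalRel, evalRel, evalRel, ← relHom_comp, F.functor.map_comp]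

theorem evalRel_id : evalRel F (fun x y : V => x = y) = 𝟙 _ := by
  rw [evalRel, relHom_id, F.functor.map_id]

theorem evalRel_comp_assoc (R : V → W → Prop) (S : W → X → Prop) {Z : C}
    (k : evalObj F X ⟶ Z) :
    evalRel F R ≫ evalRel F S ≫ k = evalRel F (Relation.Comp R S) ≫ k := by
  rw [← Category.assoc, evalRel_comp]

/-- The tensor product of morphisms, transported to the values of `F` at disjoint unions. -/
def evalTens (f : evalObj F V ⟶ evalObj F W) (g : evalObj F V' ⟶ evalObj F W') :
    evalObj F (V ⊕ V') ⟶ evalObj F (W ⊕ W') :=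
  Functor.OplaxMonoidal.δ F.functor (relObj V) (relObj V') ≫ (f ⊗ₘ g) ≫
    Functor.LaxMonoidal.μ F.functor (relObj W) (relObj W')

theorem evalTens_comp (f : evalObj F V ⟶ evalObj F W) (g : evalObj F W ⟶ evalObj F X)
    (f' : evalObj F V' ⟶ evalObj F W') (g' : evalObj F W' ⟶ evalObj F X') :
    evalTens F f f' ≫ evalTens F g g' = evalTens F (f ≫ g) (f' ≫ g') := by
  simp [evalTens]

theorem evalTens_evalRel (R : V → W → Prop) (S : V' → W' → Prop) :
    evalTens F (evalRel F R) (evalRel F S) = evalRel F (Sum.LiftRel R S) := by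
  rw [evalTens, evalRel, evalRel, evalRel, relHom_liftRel, Functor.Monoidal.map_tensor]

theorem evalTens_id : evalTens F (𝟙 (evalObj F V)) (𝟙 (evalObj F V')) = 𝟙 _ := by
  rw [evalTens, id_tensorHom_id, Category.id_comp, Functor.Monoidal.δ_μ]
  rfl

theorem evalTens_sumAssoc (f : evalObj F V ⟶ evalObj F V') (g : evalObj F W ⟶ evalObj F W')
    (h : evalObj F X ⟶ evalObj F X') :
    evalTens F (evalTens F f g) h ≫ evalRel F (fun x y => Equiv.sumAssoc V' W' X' x = y) =
      evalRel F (fun x y => Equiv.sumAssoc V W X x = y) ≫ evalTens F f (evalTens F g h) := by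
  rw [evalRel, evalRel, relHom_sumAssoc, relHom_sumAssoc]
  exact tensorHom_comp_map_associator F.functor f g h

theorem evalTens_sumComm (f : evalObj F V ⟶ evalObj F V') (g : evalObj F W ⟶ evalObj F W') :
    evalTens F f g ≫ evalRel F (fun x y => Equiv.sumComm V' W' x = y) =
      evalRel F (fun x y => Equiv.sumComm V W x = y) ≫ evalTens F g f := by
  rw [evalRel, evalRel, relHom_sumComm, relHom_sumComm, Functor.map_braiding,
    Functor.map_braiding]
  simp [evalTens]

theorem evalTens_emptySum (f : evalObj F V ⟶ evalObj F W) :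
    evalTens F (𝟙 (evalObj F (Fin 0))) f ≫
        evalRel F (fun x y => Equiv.emptySum (Fin 0) W x = y) =
      evalRel F (fun x y => Equiv.emptySum (Fin 0) V x = y) ≫ f := by
  rw [evalRel, evalRel, relHom_emptySum, relHom_emptySum]
  exact id_tensorHom_comp_map_leftUnitor F.functor f

variable (lam : F.functor.obj ⟨1⟩ ⟶ F.functor.obj ⟨1⟩)

/-- Splitting off the element `a`. -/
def splitRel {V : Type} (a : V) : V → {x : V // x ≠ a} ⊕ Fin 1 → Prop
  | x, .inl y => x = y.1
  | x, .inr _ => x = a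

/-- Putting the element `a` back. -/
def unsplitRel {V : Type} (a : V) : {x : V // x ≠ a} ⊕ Fin 1 → V → Prop
  | .inl x, y => x.1 = y
  | .inr _, y => a = y

/-- The node `lam` applied at the element `a` of `V`. -/
noncomputable def nodeAt (a : V) : evalObj F V ⟶ evalObj F V :=
  evalRel F (splitRel a) ≫
    evalTens F (W := {x : V // x ≠ a}) (V' := Fin 1) (W' := Fin 1) (𝟙 _) lam ≫
      evalRel F (unsplitRel a)

/-- The relation `R` relates `a` to `b` only, and nothing else to `b`. -/
structure Isolates {V W : Type} (R : V → W → Prop) (a : V) (b : W) : Prop where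
  left : ∀ y, R a y ↔ y = b
  right : ∀ x, R x b ↔ x = a

variable {F lam}

theorem evalRel_eq_id {R : V → V → Prop} (h : ∀ x y, R x y ↔ x = y) : evalRel F R = 𝟙 _ := by
  rw [← evalRel_id]
  exact congrArg _ (funext fun x => funext fun y => propext (h x y))

theorem splitRel_comp_unsplitRel {V : Type} (a x y : V) :
    Relation.Comp (splitRel a) (unsplitRel a) x y ↔ x = y := by
  constructor
  · rintro ⟨z | z, h, k⟩
    · exact Eq.trans h k
    · exact Eq.trans h k
  · rintro rfl
    by_cases h : x = a
    · exact ⟨.inr 0, h, h.symm⟩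
    · exact ⟨.inl ⟨x, h⟩, rfl, rfl⟩

/-- Once `a` and `b` are split off, `R` becomes the sum of its restriction `S` to the complements
and the identity of a one-element set. Its value is then a tensor product whose second factor is an
identity, and `𝟙 ⊗ lam` passes it by the interchange law. -/
theorem nodeAt_evalRel {R : V → W → Prop} {a : V} {b : W} (h : Isolates R a b) :
    nodeAt F lam a ≫ evalRel F R = evalRel F R ≫ nodeAt F lam b := by
  let S : {x : V // x ≠ a} → {y : W // y ≠ b} → Prop := fun x y => R x.1 y.1
  have h₁ : Relation.Comp (unsplitRel a) R =
      Relation.Comp (Sum.LiftRel S fun i j : Fin 1 => i = j) (unsplitRel b) := by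
    funext x y
    refine propext ?_
    rcases x with x | x
    · constructor
      · rintro ⟨_, rfl, k⟩
        have : y ≠ b := fun e => x.2 ((h.right _).1 (e ▸ k))
        exact ⟨.inl ⟨y, this⟩, .inl k, rfl⟩
      · rintro ⟨_, k, k'⟩
        cases k with
        | inl k => exact ⟨_, rfl, k' ▸ k⟩
    · constructor
      · rintro ⟨_, rfl, k⟩
        exact ⟨.inr x, .inr rfl, ((h.left _).1 k).symm⟩
      · rintro ⟨_, k, k'⟩
        cases k with
        | inr k => exact ⟨_, rfl, (h.left _).2 k'.symm⟩
  have h₂ : Relation.Comp (splitRel a) (Sum.LiftRel S fun i j : Fin 1 => i = j) =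
      Relation.Comp R (splitRel b) := by
    funext x y
    refine propext ?_
    rcases y with y | y
    · constructor
      · rintro ⟨_, k, k'⟩
        cases k' with
        | inl k' => exact ⟨_, k ▸ k', rfl⟩
      · rintro ⟨_, k, rfl⟩
        have : x ≠ a := fun e => y.2 ((h.left _).1 (e ▸ k))
        exact ⟨.inl ⟨x, this⟩, rfl, .inl k⟩
    · constructor
      · rintro ⟨_, k, k'⟩
        cases k' with
        | inr k' => exact ⟨b, (h.right _).2 k, rfl⟩
      · rintro ⟨_, k, rfl⟩
        exact ⟨.inr y, (h.right _).1 k, .inr rfl⟩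
  rw [nodeAt, nodeAt, Category.assoc, Category.assoc, evalRel_comp, h₁, ← evalRel_comp,
    ← evalTens_evalRel, ← Category.assoc (evalTens _ _ _), evalTens_comp, Category.id_comp,
    evalRel_id, evalRel_comp_assoc, ← h₂, ← evalRel_comp, ← evalTens_evalRel, evalRel_id,
    Category.assoc, ← Category.assoc (evalTens _ _ _) (evalTens _ _ _), evalTens_comp,
    Category.comp_id, Category.comp_id, Category.id_comp]

theorem isolates_equiv {V W : Type} (e : V ≃ W) (a : V) : Isolates (fun x y => e x = y) a (e a) :=
  ⟨fun _ => eq_comm, fun _ => e.apply_eq_iff_eq⟩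

theorem isIso_evalRel_equiv (e : V ≃ W) : IsIso (evalRel F fun x y => e x = y) :=
  ⟨evalRel F fun x y => e.symm x = y, by
    rw [evalRel_comp, relComp_eq_left]
    exact evalRel_eq_id (by simp), by
    rw [evalRel_comp, relComp_eq_left]
    exact evalRel_eq_id (by simp)⟩

theorem isolates_splitRel {V : Type} (a : V) : Isolates (splitRel a) a (.inr 0) := by
  refine ⟨?_, fun x => Iff.rfl⟩
  rintro (y | y)
  · simpa [splitRel] using y.2.symm
  · simpa [splitRel] using Subsingleton.elim _ _

/-- The node at the last element of `V ⊕ Fin 1`. -/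
theorem nodeAt_inr_zero :
    nodeAt F lam (.inr 0 : V ⊕ Fin 1) = evalTens F (V' := Fin 1) (W' := Fin 1) (𝟙 _) lam := by
  -- `S` identifies the complement of the last element with `V`. It slides past `𝟙 ⊗ lam` and then
  -- joins the splitting to form an identity.
  let S : {x : V ⊕ Fin 1 // x ≠ .inr 0} → V → Prop := fun x y => x.1 = .inl y
  have h₁ : unsplitRel (.inr 0 : V ⊕ Fin 1) = Sum.LiftRel S fun i j : Fin 1 => i = j := by
    funext x y
    refine propext ?_
    rcases x with x | x <;> rcases y with y | y <;>
      simp [unsplitRel, S, Subsingleton.elim _ (0 : Fin 1)]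
    exact fun e => x.2 e
  have h₂ : ∀ x y, Relation.Comp (splitRel (.inr 0 : V ⊕ Fin 1))
      (Sum.LiftRel S fun i j : Fin 1 => i = j) x y ↔ x = y := by
    rw [← h₁]
    exact splitRel_comp_unsplitRel _
  rw [nodeAt, h₁, ← evalTens_evalRel, evalTens_comp, Category.id_comp, evalRel_id,
    Category.comp_id]
  have := evalTens_comp F (X' := Fin 1) (evalRel F S) (𝟙 _) (𝟙 (evalObj F (Fin 1))) lam
  rw [Category.comp_id, Category.id_comp] at this
  rw [← this, ← evalRel_id, evalTens_evalRel, evalRel_comp_assoc, evalRel_eq_id h₂,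
    Category.id_comp]

theorem isolates_lift_inr {V W X : Type} {R : V → W → Prop} {a : V} {b : W} (h : Isolates R a b) :
    Isolates (Sum.LiftRel (fun x y : X => x = y) R) (.inr a) (.inr b) := by
  constructor
  · rintro (y | y) <;> simp [h.left]
  · rintro (y | y) <;> simp [h.right]

/-- Splitting off `a` inside `W` and reassociating brings the node to the last place, where
`nodeAt_inr_zero` computes it; putting `a` back inside `W` undoes the splitting. -/
theorem nodeAt_inr (a : W) :
    nodeAt F lam (.inr a : V ⊕ W) = evalTens F (𝟙 _) (nodeAt F lam a) := by
  have hs := nodeAt_evalRel (F := F) (lam := lam) (isolates_lift_inr (X := V) (isolates_splitRel a))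
  have ha := nodeAt_evalRel (F := F) (lam := lam)
    (isolates_equiv (Equiv.sumAssoc V {x : W // x ≠ a} (Fin 1)) (.inr 0))
  change _ = _ ≫ nodeAt F lam (Sum.inr (Sum.inr 0)) at ha
  rw [nodeAt_inr_zero, ← evalTens_id, evalTens_sumAssoc] at ha
  have := isIso_evalRel_equiv (F := F) (Equiv.sumAssoc V {x : W // x ≠ a} (Fin 1))
  rw [cancel_epi] at ha
  rw [← ha] at hs
  have hu : Relation.Comp (Sum.LiftRel (fun x y : V => x = y) (splitRel a))
      (Sum.LiftRel (fun x y : V => x = y) (unsplitRel a)) = fun x y => x = y := by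
    have := relSystem.tens_comp (fun x y : V => x = y) (fun x y : V => x = y) (splitRel a)
      (unsplitRel a)
    refine this.trans ?_
    funext x y
    refine propext ?_
    have h := splitRel_comp_unsplitRel a
    rcases x with x | x <;> rcases y with y | y
    · simp [relSystem]
    · simp [relSystem]
    · simp [relSystem]
    · simpa [relSystem] using h x y
  have hs' := congrArg (· ≫ evalRel F (Sum.LiftRel (fun x y : V => x = y) (unsplitRel a))) hs
  simp only [Category.assoc, evalRel_comp, hu] at hs'
  rw [evalRel_id, Category.comp_id] at hs'
  rw [hs', ← evalTens_evalRel, ← evalTens_evalRel, evalTens_comp, evalTens_comp, evalRel_id,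
    nodeAt]
  simp

theorem nodeAt_inl (a : V) :
    nodeAt F lam (.inl a : V ⊕ W) = evalTens F (nodeAt F lam a) (𝟙 _) := by
  have h := nodeAt_evalRel (F := F) (lam := lam) (isolates_equiv (Equiv.sumComm V W) (.inl a))
  change _ = _ ≫ nodeAt F lam (Sum.inr a) at h
  rw [nodeAt_inr, ← evalTens_sumComm] at h
  have := isIso_evalRel_equiv (F := F) (Equiv.sumComm V W)
  rwa [cancel_mono] at h

/-- After `a` is split off, the two nodes act on different tensor factors. The splitting has a left
inverse relation, so its value is a monomorphism and the identity can be tested behind it. -/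
theorem nodeAt_comm {a b : V} (hab : a ≠ b) :
    nodeAt F lam a ≫ nodeAt F lam b = nodeAt F lam b ≫ nodeAt F lam a := by
  have hb : Isolates (splitRel a) b (.inl ⟨b, hab.symm⟩) := by
    constructor
    · rintro (y | y)
      · simp [splitRel, Subtype.ext_iff, eq_comm]
      · simpa [splitRel] using hab.symm
    · exact fun x => Iff.rfl
  have ha := isolates_splitRel a
  have hu : evalRel F (splitRel a) ≫ evalRel F (unsplitRel a) = 𝟙 _ := by
    rw [evalRel_comp, evalRel_eq_id (splitRel_comp_unsplitRel a)]
  have : Mono (evalRel F (splitRel a)) := mono_of_mono_fac hu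
  rw [← cancel_mono (evalRel F (splitRel a)), Category.assoc, Category.assoc, nodeAt_evalRel hb,
    nodeAt_evalRel ha, ← Category.assoc, ← Category.assoc, nodeAt_evalRel hb, nodeAt_evalRel ha,
    Category.assoc, Category.assoc, nodeAt_inr_zero, nodeAt_inl, evalTens_comp, evalTens_comp]
  simp

/-- The definition of `nodeAt` leaves an empty complement as a tensor factor; the left unitor `0 + 1
≅ 1` removes it. -/
theorem nodeAt_fin_one : nodeAt F lam (0 : Fin 1) = lam := by
  have h := nodeAt_evalRel (F := F) (lam := lam)
    (isolates_equiv (Equiv.emptySum (Fin 0) (Fin 1)) (.inr 0))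
  change _ = _ ≫ nodeAt F lam 0 at h
  have e := evalTens_emptySum F (V := Fin 1) (W := Fin 1) lam
  have := isIso_evalRel_equiv (F := F) (Equiv.emptySum (Fin 0) (Fin 1))
  rw [nodeAt_inr_zero, e, cancel_epi] at h
  exact h.symm

end Extension

/-! ### Topological sortings -/

namespace IDag

variable {I O : Type}

/-- Acyclicity makes reachability antisymmetric, hence a partial order; a linear extension of it on
the finite set of nodes is order isomorphic to an ordinal. -/
theorem nonempty_topSort (D : IDag I O) : Nonempty D.TopSort := by
  let r : D.N → D.N → Prop := fun a b => D.R (.inr a) (.inr b)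
  let : PartialOrder D.N :=
    { le := Relation.ReflTransGen r
      le_refl := fun _ => .refl
      le_trans := fun _ _ _ => .trans
      le_antisymm := by
        intro a b hab hba
        rcases Relation.reflTransGen_iff_eq_or_transGen.1 hab with h | h
        · exact h.symm
        · exact (D.acyclic a (h.trans_left hba)).elim }
  let : Fintype (LinearExtension D.N) := Fintype.ofFinite D.N
  have hc : Fintype.card (LinearExtension D.N) = Nat.card D.N :=
    (Nat.card_eq_fintype_card (α := LinearExtension D.N)).symm
  let e := Fintype.orderIsoFinOfCardEq (LinearExtension D.N) hc
  refine ⟨⟨e.toEquiv, fun i j h => ?_⟩⟩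
  have hle : e i ≤ e j :=
    (toLinearExtension : D.N →o _).monotone (Relation.ReflTransGen.single h)
  refine lt_of_le_of_ne (e.le_iff_le.1 hle) ?_
  rintro rfl
  exact D.acyclic _ (.single h)

/-- The nodes listed in an order compatible with the edges. -/
structure IsSorted {N : Type} (R : I ⊕ N → O ⊕ N → Prop) (l : List N) : Prop where
  nodup : l.Nodup
  mem : ∀ a, a ∈ l
  pairwise : l.Pairwise fun a b => ¬ R (.inr b) (.inr a)

theorem exists_isSorted (D : IDag I O) : ∃ l, IsSorted D.R l := by
  obtain ⟨σ⟩ := D.nonempty_topSort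
  refine ⟨List.ofFn σ.toEquiv, List.nodup_ofFn.2 σ.toEquiv.injective, fun a => ?_, ?_⟩
  · rw [List.mem_ofFn]
    exact σ.toEquiv.surjective a
  · rw [List.pairwise_ofFn]
    exact fun i j hij h => lt_asymm hij (σ.lt_of_edge _ _ h)

theorem IsSorted.map {N N' : Type} {R : I ⊕ N → O ⊕ N → Prop} {R' : I ⊕ N' → O ⊕ N' → Prop}
    {l : List N} (hl : IsSorted R l) {σ : N ≃ N'} (h : RelIso σ R R') : IsSorted R' (l.map σ) := by
  refine ⟨hl.nodup.map σ.injective, fun a => ?_, ?_⟩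
  · exact List.mem_map.2 ⟨σ.symm a, hl.mem _, by simp⟩
  · rw [List.pairwise_map]
    exact hl.pairwise.imp fun {a b} hab k => hab ((h (.inr b) (.inr a)).2 k)

theorem IsSorted.concatRel {M N N' : Type} {R : I ⊕ N → M ⊕ N → Prop}
    {R' : M ⊕ N' → O ⊕ N' → Prop} {l : List N} {l' : List N'} (hl : IsSorted R l)
    (hl' : IsSorted R' l') : IsSorted (concatRel R R') (l.map Sum.inl ++ l'.map Sum.inr) := by
  refine ⟨?_, ?_, ?_⟩
  · refine (hl.nodup.map Sum.inl_injective).append (hl'.nodup.map Sum.inr_injective) ?_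
    intro x hx hx'
    obtain ⟨a, -, rfl⟩ := List.mem_map.1 hx
    obtain ⟨b, -, hb⟩ := List.mem_map.1 hx'
    simp at hb
  · rintro (a | a)
    · exact List.mem_append_left _ (List.mem_map.2 ⟨a, hl.mem a, rfl⟩)
    · exact List.mem_append_right _ (List.mem_map.2 ⟨a, hl'.mem a, rfl⟩)
  · rw [List.pairwise_append, List.pairwise_map, List.pairwise_map]
    refine ⟨hl.pairwise, hl'.pairwise, fun x hx y hy => ?_⟩
    obtain ⟨a, -, rfl⟩ := List.mem_map.1 hx
    obtain ⟨b, -, rfl⟩ := List.mem_map.1 hy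
    exact id

theorem IsSorted.juxtRel {I' O' N : Type} {R : I ⊕ N → O ⊕ N → Prop} (S : I' → O' → Prop)
    {l : List N} (hl : IsSorted R l) :
    IsSorted (juxtRel R (pureRel S)) (l.map Sum.inl) := by
  refine ⟨hl.nodup.map Sum.inl_injective, ?_, ?_⟩
  · rintro (a | a)
    · exact List.mem_map.2 ⟨a, hl.mem a, rfl⟩
    · exact a.elim
  · rw [List.pairwise_map]
    simpa [IDag.juxtRel, regroup] using hl.pairwise

end IDag

/-! ### Composites of endomorphisms along a list, and independence of the order -/

section ListComp

variable {C : Type u} [Category.{v} C] {X Y : C} {N N' : Type}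

/-- The composite of a family of endomorphisms along a list. -/
def listComp (T : N → (X ⟶ X)) : List N → (X ⟶ X)
  | [] => 𝟙 X
  | a :: l => T a ≫ listComp T l

theorem listComp_append (T : N → (X ⟶ X)) (l l' : List N) :
    listComp T (l ++ l') = listComp T l ≫ listComp T l' := by
  induction l with
  | nil => simp [listComp]
  | cons a l ih => simp [listComp, ih]

theorem listComp_comp {T : N → (X ⟶ X)} {T' : N' → (Y ⟶ Y)} {ρ : X ⟶ Y} {f : N → N'}
    (h : ∀ a, T a ≫ ρ = ρ ≫ T' (f a)) (l : List N) :
    listComp T l ≫ ρ = ρ ≫ listComp T' (l.map f) := by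
  induction l with
  | nil => simp [listComp]
  | cons a l ih => rw [listComp, Category.assoc, ih, ← Category.assoc, h, Category.assoc]; rfl

theorem listComp_comm {T : N → (X ⟶ X)} {g : X ⟶ X} {l : List N}
    (h : ∀ a ∈ l, T a ≫ g = g ≫ T a) : listComp T l ≫ g = g ≫ listComp T l := by
  induction l with
  | nil => simp [listComp]
  | cons a l ih =>
    rw [listComp, Category.assoc, ih fun b hb => h b (List.mem_cons_of_mem a hb),
      ← Category.assoc, h a List.mem_cons_self, Category.assoc]

/-- The composite does not depend on the order of the list, as long as the order is compatible with
a relation `r` such that unrelated endomorphisms commute. -/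
theorem listComp_eq_of_perm {T : N → (X ⟶ X)} {r : N → N → Prop}
    (hT : ∀ a b, a ≠ b → ¬ r a b → ¬ r b a → T a ≫ T b = T b ≫ T a) :
    ∀ {l l' : List N}, l.Perm l' → l.Nodup → l.Pairwise (fun a b => ¬ r b a) →
      l'.Pairwise (fun a b => ¬ r b a) → listComp T l = listComp T l'
  | [], l', hp, _, _, _ => by rw [List.nil_perm.1 hp]
  | a :: l, l', hp, hn, hl, hl' => by
    -- In `l' = s ++ a :: t` the head `a` is moved to the front. Each `b` in `s` precedes `a` in
    -- `l'` but follows it in the other list, so there is no relation between `a` and `b` in either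
    -- direction and they commute.
    obtain ⟨s, t, rfl⟩ := List.append_of_mem (hp.subset List.mem_cons_self)
    have hp' : l.Perm (s ++ t) := List.Perm.cons_inv (hp.trans List.perm_middle)
    rw [List.nodup_cons] at hn
    rw [List.pairwise_cons] at hl
    have hst : (s ++ t).Pairwise (fun a b => ¬ r b a) :=
      hl'.sublist ((List.Sublist.refl s).append (List.sublist_cons_self a t))
    rw [listComp, listComp_eq_of_perm hT hp' hn.2 hl.2 hst, listComp_append, listComp_append,
      listComp, ← Category.assoc, ← Category.assoc, listComp_comm]
    intro b hb
    have hbl : b ∈ l := hp'.mem_iff.2 (List.mem_append_left t hb)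
    refine hT b a (fun e => hn.1 (e ▸ hbl)) (hl.1 b hbl) ?_
    exact (List.pairwise_append.1 hl').2.2 b hb a List.mem_cons_self

end ListComp

instance : Enumerated Empty := ⟨0, Equiv.equivOfIsEmpty _ _⟩

instance : Enumerated Unit := ⟨1, Equiv.ofUnique _ _⟩

/-! ### Interpretation of dags along lists of nodes -/

section Gather

variable {C : Type u} [Category.{v} C] [MonoidalCategory C] [SymmetricCategory C]
  (F : SymMonFunctor RelProp C) (lam : F.functor.obj ⟨1⟩ ⟶ F.functor.obj ⟨1⟩)
  {V W J : Type} [Enumerated V] [Enumerated W] [Enumerated J]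

/-- The identity together with edges to `a` from the elements of `p`. -/
def gatherRel {V : Type} (p : V → Prop) (a : V) (x y : V) : Prop := x = y ∨ (y = a ∧ p x)

/-- Gather the elements of `p` at `a`, then apply the node at `a`. -/
noncomputable def gatherStep (p : V → Prop) (a : V) : evalObj F V ⟶ evalObj F V :=
  evalRel F (gatherRel p a) ≫ nodeAt F lam a

variable {F lam}

/-- The criterion by which `ρ` intertwines steps. The second hypothesis makes `p` the preimage of
`q` along `ρ`, so gathering before or after `ρ` gives the same relation; the first lets the node
pass. -/
theorem gatherStep_comp {p : V → Prop} {q : W → Prop} {a : V} {b : W} {ρ : V → W → Prop}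
    (hρ : Isolates ρ a b) (h : ∀ x, p x ↔ ∃ z, ρ x z ∧ q z) :
    gatherStep F lam p a ≫ evalRel F ρ = evalRel F ρ ≫ gatherStep F lam q b := by
  have hc : Relation.Comp (gatherRel p a) ρ = Relation.Comp ρ (gatherRel q b) := by
    funext x y
    refine propext ⟨?_, ?_⟩
    · rintro ⟨z, rfl | ⟨rfl, hp⟩, hz⟩
      · exact ⟨y, hz, .inl rfl⟩
      · obtain ⟨w, hw, hq⟩ := (h x).1 hp
        exact ⟨w, hw, .inr ⟨(hρ.left y).1 hz, hq⟩⟩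
    · rintro ⟨z, hz, rfl | ⟨rfl, hq⟩⟩
      · exact ⟨x, .inl rfl, hz⟩
      · exact ⟨a, .inr ⟨rfl, (h x).2 ⟨z, hz, hq⟩⟩, (hρ.left _).2 rfl⟩
  rw [gatherStep, gatherStep, Category.assoc, nodeAt_evalRel hρ, evalRel_comp_assoc,
    evalRel_comp_assoc, hc]

theorem isolates_gatherRel {V : Type} {q : V → Prop} {a b : V} (hab : a ≠ b) (hq : ¬ q a) :
    Isolates (gatherRel q b) a a := by
  refine ⟨fun y => ?_, fun x => ?_⟩
  · simp [gatherRel, hq, eq_comm]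
  · simp [gatherRel, hab]

/-- As neither element is gathered into the other, each gathering isolates the other element. Both
nodes can be moved behind both gatherings, and then relations commute with relations and nodes with
nodes. -/
theorem gatherStep_comm {p q : V → Prop} {a b : V} (hab : a ≠ b) (hp : ¬ p b) (hq : ¬ q a) :
    gatherStep F lam p a ≫ gatherStep F lam q b = gatherStep F lam q b ≫ gatherStep F lam p a := by
  have hc : Relation.Comp (gatherRel p a) (gatherRel q b) =
      Relation.Comp (gatherRel q b) (gatherRel p a) := by
    funext x y
    simp only [Relation.Comp, gatherRel]
    grind
  simp only [gatherStep, Category.assoc]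
  rw [← Category.assoc (nodeAt F lam a), nodeAt_evalRel (isolates_gatherRel hab hq),
    ← Category.assoc (nodeAt F lam b) (evalRel F _),
    nodeAt_evalRel (isolates_gatherRel hab.symm hp)]
  simp only [Category.assoc, evalRel_comp_assoc, hc, nodeAt_comm hab]

/-- Idle wires `J` contribute nothing to the gathering. -/
theorem evalTens_gatherStep (p : V → Prop) (a : V) :
    evalTens F (gatherStep F lam p a) (𝟙 (evalObj F J)) =
      gatherStep F lam (Sum.elim p fun _ => False) (.inl a) := by
  have h : gatherRel (Sum.elim p fun _ => False) (.inl a) =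
      Sum.LiftRel (gatherRel p a) fun x y : J => x = y := by
    funext x y
    rcases x with x | x <;> rcases y with y | y <;> simp [gatherRel]
  rw [gatherStep, gatherStep, h, nodeAt_inl, ← evalTens_evalRel, evalTens_comp, evalRel_id,
    Category.comp_id]

theorem evalTens_listComp {N : Type} (T : N → (evalObj F V ⟶ evalObj F V)) (l : List N) :
    evalTens F (listComp T l) (𝟙 (evalObj F J)) =
      listComp (fun a => evalTens F (T a) (𝟙 (evalObj F J))) l := by
  induction l with
  | nil => exact evalTens_id F
  | cons a l ih => rw [listComp, listComp, ← ih, evalTens_comp, Category.comp_id]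

end Gather

/-! ### Invariance of the interpretation; concatenation and juxtaposition -/

namespace IDag

variable {C : Type u} [Category.{v} C] [MonoidalCategory C] [SymmetricCategory C]
  (F : SymMonFunctor RelProp C) (lam : F.functor.obj ⟨1⟩ ⟶ F.functor.obj ⟨1⟩)
  {I O M J J' N N' : Type} [Enumerated I] [Enumerated O] [Enumerated M] [Enumerated J]
  [Enumerated J'] [Enumerated N'] [Enumerated N]

/-- The step of the interpretation at the node `a`, on the inputs and the nodes of a dag with
edges `R`. -/
noncomputable def nodeStep (R : I ⊕ N → O ⊕ N → Prop) (a : N) :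
    evalObj F (I ⊕ N) ⟶ evalObj F (I ⊕ N) :=
  gatherStep F lam (fun x => R x (.inr a)) (.inr a)

/-- The interpretation of a dag with edges `R` along a list of its nodes: start with the inputs,
run through the nodes, and collect the outputs. -/
noncomputable def evalList (R : I ⊕ N → O ⊕ N → Prop) (l : List N) : evalObj F I ⟶ evalObj F O :=
  -- No input is related to a node here, so the registers of the nodes start with the unit. Having
  -- them all from the beginning makes every step an endomorphism of the same object.
  evalRel F (fun i (x : I ⊕ N) => .inl i = x) ≫ listComp (nodeStep F lam R) l ≫
    evalRel F (fun x o => R x (.inl o))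

/-- The interpretation of a dag. -/
noncomputable def eval (D : IDag I O) : evalObj F I ⟶ evalObj F O :=
  evalList F lam D.R D.exists_isSorted.choose

variable {F lam}

theorem evalList_eq_of_isSorted {R : I ⊕ N → O ⊕ N → Prop} {l l' : List N} (hl : IsSorted R l)
    (hl' : IsSorted R l') : evalList F lam R l = evalList F lam R l' := by
  rw [evalList, evalList, listComp_eq_of_perm (r := fun a b => R (.inr a) (.inr b)) _
    ((List.perm_ext_iff_of_nodup hl.nodup hl'.nodup).2 fun a => by simp [hl.mem, hl'.mem])
    hl.nodup hl.pairwise hl'.pairwise]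
  exact fun a b hab h h' => gatherStep_comm (fun e => hab (Sum.inr_injective e)) h' h

/-- The steps are intertwined by the graph of `σ`. With `σ` the identity between two enumerations of
one set, this also covers a change of enumeration. -/
theorem evalList_congr {R : I ⊕ N → O ⊕ N → Prop} {R' : I ⊕ N' → O ⊕ N' → Prop} {σ : N ≃ N'}
    (h : RelIso σ R R') (l : List N) : evalList F lam R l = evalList F lam R' (l.map σ) := by
  let ρ : I ⊕ N → I ⊕ N' → Prop := fun x y => Equiv.sumCongr (Equiv.refl I) σ x = y
  have hρ : ∀ a, nodeStep F lam R a ≫ evalRel F ρ = evalRel F ρ ≫ nodeStep F lam R' (σ a) :=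
    fun a => gatherStep_comp (isolates_equiv _ (Sum.inr a)) fun x => by
      simpa [ρ] using h x (.inr a)
  have h₁ : (fun i (x : I ⊕ N') => .inl i = x) =
      Relation.Comp (fun i (x : I ⊕ N) => .inl i = x) ρ := by
    funext i x
    simp [Relation.Comp, ρ]
  have h₂ : (fun x o => R x (.inl o)) = Relation.Comp ρ fun x o => R' x (.inl o) := by
    funext x o
    simpa [Relation.Comp, ρ] using h x (.inl o)
  rw [evalList, evalList, h₁, h₂, ← evalRel_comp, ← evalRel_comp, ← Category.assoc (listComp _ _),
    listComp_comp hρ]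
  simp only [Category.assoc]

/-- Replaces the arbitrary list and the arbitrary enumeration in `eval` by whichever suit a
construction, such as those of a sum of node sets. -/
theorem eval_eq_evalList {D : IDag I O} {R : I ⊕ N → O ⊕ N → Prop} {l : List N} (hl : IsSorted R l)
    {σ : N ≃ D.N} (h : RelIso σ R D.R) : eval F lam D = evalList F lam R l := by
  rw [evalList_congr h]
  exact evalList_eq_of_isSorted D.exists_isSorted.choose_spec (hl.map h)

theorem relIso_refl {I O N : Type} (R : I ⊕ N → O ⊕ N → Prop) : RelIso (Equiv.refl N) R R :=
  fun x y => by simp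

theorem eval_congr {D D' : IDag I O} (σ : D.N ≃ D'.N) (h : RelIso σ D.R D'.R) :
    eval F lam D = eval F lam D' :=
  (eval_eq_evalList D.exists_isSorted.choose_spec h).symm

theorem eval_ofRel (R : I → O → Prop) : eval F lam (ofRel R) = evalRel F R := by
  refine (eval_eq_evalList (D := ofRel R) (R := pureRel R) (l := [])
    ⟨List.nodup_nil, fun a => a.elim, .nil⟩ (relIso_refl _)).trans ?_
  rw [evalList, listComp, Category.id_comp, evalRel_comp]
  congr 1
  funext x y
  simp [Relation.Comp, pureRel]

/-- The relation from the vertices of a concatenation to those of the second dag. -/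
def concatOut {I M N : Type} (R : I ⊕ N → M ⊕ N → Prop) (N' : Type) :
    I ⊕ (N ⊕ N') → M ⊕ N' → Prop
  | .inl i, .inl m => R (.inl i) (.inl m)
  | .inr (.inl a), .inl m => R (.inr a) (.inl m)
  | .inr (.inr a), .inr b => a = b
  | _, _ => False

/-- The inclusion `ι` of the vertices of the first dag intertwines the steps at its nodes, and `ρ`,
which sends these vertices to the interface along `R`, intertwines the steps at the nodes of the
second dag. The composite of `ι` and `ρ` is the end of the first run followed by the start of the
second (`h₃`). -/
theorem evalList_concatRel (R : I ⊕ N → M ⊕ N → Prop) (R' : M ⊕ N' → O ⊕ N' → Prop) (l : List N)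
    (l' : List N') : evalList F lam (concatRel R R') (l.map Sum.inl ++ l'.map Sum.inr) =
      evalList F lam R l ≫ evalList F lam R' l' := by
  let ι : I ⊕ N → I ⊕ (N ⊕ N') → Prop := fun x y => Sum.map id Sum.inl x = y
  let ρ := concatOut R N'
  have hι : ∀ a, nodeStep F lam R a ≫ evalRel F ι =
      evalRel F ι ≫ nodeStep F lam (concatRel R R') (.inl a) := by
    intro a
    refine gatherStep_comp ⟨fun y => ?_, fun x => ?_⟩ fun x => ?_
    · simp [ι, eq_comm]
    · rcases x with x | x <;> simp [ι]
    · rcases x with x | x <;> simp [ι, concatRel]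
  -- Edges into a node of the second dag are redirected through the interface, so its predecessors
  -- in the concatenation are the preimage along `ρ` of those in `R'`.
  have hρ : ∀ a, nodeStep F lam (concatRel R R') (.inr a) ≫ evalRel F ρ =
      evalRel F ρ ≫ nodeStep F lam R' a := by
    intro a
    refine gatherStep_comp ⟨fun y => ?_, fun x => ?_⟩ fun x => ?_
    · rcases y with y | y <;> simp [ρ, concatOut, eq_comm]
    · rcases x with x | x | x <;> simp [ρ, concatOut]
    · rcases x with x | x | x <;> simp [ρ, concatOut, concatRel]
  have h₁ : (fun i (x : I ⊕ (N ⊕ N')) => .inl i = x) =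
      Relation.Comp (fun i (x : I ⊕ N) => .inl i = x) ι := by
    funext i x
    simp [Relation.Comp, ι]
  have h₂ : (fun x o => concatRel R R' x (.inl o)) =
      Relation.Comp ρ fun x o => R' x (.inl o) := by
    funext x o
    rcases x with x | x | x <;> simp [Relation.Comp, ρ, concatOut, concatRel]
  have h₃ : Relation.Comp ι ρ = Relation.Comp (fun x o => R x (.inl o))
      (fun i (x : M ⊕ N') => .inl i = x) := by
    funext x o
    rcases x with x | x <;> rcases o with o | o <;> simp [Relation.Comp, ρ, concatOut, ι]
  have hρ' : ∀ l : List N', listComp (nodeStep F lam (concatRel R R')) (l.map Sum.inr) ≫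
      evalRel F ρ = evalRel F ρ ≫ listComp (nodeStep F lam R') l := by
    intro l
    induction l with
    | nil => simp [listComp]
    | cons a l ih =>
      rw [List.map_cons, listComp, Category.assoc, ih, ← Category.assoc, hρ, Category.assoc]
      rfl
  rw [evalList, evalList, evalList, listComp_append, h₁, h₂, ← evalRel_comp, ← evalRel_comp]
  simp only [Category.assoc]
  rw [← Category.assoc (listComp _ _) (evalRel F ρ), hρ',
    ← Category.assoc (evalRel F ι) (listComp _ _), ← listComp_comp hι]
  simp only [Category.assoc]
  rw [evalRel_comp_assoc, h₃, ← evalRel_comp_assoc]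

theorem eval_concat (D : IDag I M) (D' : IDag M O) :
    eval F lam (D.concat D') = eval F lam D ≫ eval F lam D' := by
  obtain ⟨l, hl⟩ := D.exists_isSorted
  obtain ⟨l', hl'⟩ := D'.exists_isSorted
  rw [eval_eq_evalList hl (relIso_refl _), eval_eq_evalList hl' (relIso_refl _),
    ← evalList_concatRel]
  exact eval_eq_evalList (D := D.concat D') (hl.concatRel hl') (relIso_refl _)

/-- The bijection `(I + N) + J ≅ (I + J) + (N + ∅)`. -/
def juxtEquiv (I N J : Type) : (I ⊕ N) ⊕ J ≃ (I ⊕ J) ⊕ (N ⊕ Empty) where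
  toFun
    | .inl (.inl i) => .inl (.inl i)
    | .inl (.inr a) => .inr (.inl a)
    | .inr j => .inl (.inr j)
  invFun
    | .inl (.inl i) => .inl (.inl i)
    | .inr (.inl a) => .inl (.inr a)
    | .inl (.inr j) => .inr j
  left_inv := by rintro ((x | x) | x) <;> rfl
  right_inv := by
    rintro ((x | x) | x | x)
    · rfl
    · rfl
    · rfl
    · exact x.elim

/-- The wires of `J` stay idle during the run and `S` acts on them at the end. A right factor
without nodes is all that whiskering requires. -/
theorem evalList_juxtRel (R : I ⊕ N → O ⊕ N → Prop) (S : J → J' → Prop) (l : List N) :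
    evalList F lam (juxtRel R (pureRel S)) (l.map Sum.inl) =
      evalTens F (evalList F lam R l) (evalRel F S) := by
  let ρ : (I ⊕ N) ⊕ J → (I ⊕ J) ⊕ (N ⊕ Empty) → Prop := fun x y => juxtEquiv I N J x = y
  have hρ : ∀ a, evalTens F (nodeStep F lam R a) (𝟙 (evalObj F J)) ≫ evalRel F ρ =
      evalRel F ρ ≫ nodeStep F lam (juxtRel R (pureRel S)) (.inl a) := by
    intro a
    rw [nodeStep, evalTens_gatherStep]
    refine gatherStep_comp (isolates_equiv _ (Sum.inl (Sum.inr a))) fun x => ?_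
    rcases x with (x | x) | x <;> simp [ρ, juxtEquiv, juxtRel, regroup]
  have h₁ : (fun i (x : (I ⊕ J) ⊕ (N ⊕ Empty)) => .inl i = x) =
      Relation.Comp (Sum.LiftRel (fun i (x : I ⊕ N) => .inl i = x) fun x y : J => x = y) ρ := by
    funext i x
    rcases i with i | i <;> simp [Relation.Comp, ρ, juxtEquiv]
  have h₂ : Sum.LiftRel (fun x o => R x (.inl o)) S =
      Relation.Comp ρ fun x o => juxtRel R (pureRel S) x (.inl o) := by
    funext x o
    rcases x with (x | x) | x <;> rcases o with o | o <;>
      simp [Relation.Comp, ρ, juxtEquiv, juxtRel, regroup, pureRel]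
  have h₃ := evalTens_comp F (evalRel F (fun i (x : I ⊕ N) => .inl i = x))
    (listComp (nodeStep F lam R) l ≫ evalRel F (fun x o => R x (.inl o))) (𝟙 (evalObj F J))
    (evalRel F S)
  have h₄ := evalTens_comp F (listComp (nodeStep F lam R) l) (evalRel F (fun x o => R x (.inl o)))
    (𝟙 (evalObj F J)) (evalRel F S)
  rw [Category.id_comp] at h₃ h₄
  rw [evalList, evalList, ← h₃, ← h₄, evalTens_listComp, evalTens_evalRel, h₂, ← evalRel_comp,
    ← Category.assoc (listComp _ _), listComp_comp hρ, ← evalRel_id, evalTens_evalRel, h₁,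
    ← evalRel_comp]
  simp only [Category.assoc]

theorem eval_juxt_ofRel (D : IDag I O) (S : J → J' → Prop) :
    eval F lam (D.juxt (ofRel S)) = evalTens F (eval F lam D) (evalRel F S) := by
  obtain ⟨l, hl⟩ := D.exists_isSorted
  rw [eval_eq_evalList hl (relIso_refl _), ← evalList_juxtRel]
  exact eval_eq_evalList (D := D.juxt (ofRel S)) (hl.juxtRel S) (relIso_refl _)

/-- The hypothesis says that the edges are exactly those from the input to the node and from the
node to the output. Once the node is moved behind the output relation, the remaining relations
compose to the identity of one wire. -/
theorem evalList_single {R : Fin 1 ⊕ Unit → Fin 1 ⊕ Unit → Prop}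
    (h : ∀ x y, R x y ↔ x.isLeft = y.isRight) : evalList F lam R [()] = lam := by
  rw [evalList, listComp, listComp, Category.comp_id, nodeStep, gatherStep, Category.assoc,
    nodeAt_evalRel (b := (0 : Fin 1)) ⟨fun y => ?_, fun x => ?_⟩]
  · simp only [nodeAt_fin_one, evalRel_comp_assoc]
    rw [evalRel_eq_id, Category.id_comp]
    intro x y
    simp [Relation.Comp, gatherRel, h, Subsingleton.elim x y]
  · simpa [h] using Subsingleton.elim _ _
  · rcases x with x | x <;> simp [h]

theorem eval_singleNode : eval F lam singleNode = lam := by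
  refine (eval_eq_evalList (D := singleNode) (N := Unit) (R := singleNode.R) (l := [()])
    ⟨by simp, fun a => by simp, by simp⟩ (relIso_refl _)).trans (evalList_single ?_)
  rintro (x | x) (y | y) <;> simp [singleNode]

end IDag

/-! ### Equality of symmetric monoidal functors -/

namespace SymMonFunctor

variable {C : Type u₁} [Category.{v₁} C] [MonoidalCategory C] [SymmetricCategory C]
  {D : Type u₂} [Category.{v₂} D] [MonoidalCategory D] [SymmetricCategory D]

open Functor.LaxMonoidal

/-- A strong monoidal structure is determined by `ε` and `μ`, and compatibility with the braiding is
a property. -/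
theorem ext_of_eqToHom {F G : SymMonFunctor C D}
    (hobj : ∀ X, F.functor.obj X = G.functor.obj X)
    (hmap : ∀ {X Y : C} (f : X ⟶ Y),
      F.functor.map f ≫ eqToHom (hobj Y) = eqToHom (hobj X) ≫ G.functor.map f)
    (hε : ε F.functor ≫ eqToHom (hobj (𝟙_ C)) = ε G.functor)
    (hμ : ∀ X Y, μ F.functor X Y ≫ eqToHom (hobj (X ⊗ Y)) =
      (eqToHom (hobj X) ⊗ₘ eqToHom (hobj Y)) ≫ μ G.functor X Y) : F = G := by
  obtain @⟨F, iF⟩ := F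
  obtain @⟨G, iG⟩ := G
  have h : F = G := CategoryTheory.Functor.ext hobj fun X Y f => by
    rw [← Category.assoc, ← hmap f]
    simp
  subst h
  have : iF = iG := by
    apply Functor.Braided.toMonoidal_injective
    apply Functor.Monoidal.toLaxMonoidal_injective
    apply Functor.LaxMonoidal.ext
    · simpa using hε
    · funext X Y
      simpa using hμ X Y
  rw [this]

theorem map_eqToHom_of_eq {F G : SymMonFunctor C D} (h : F = G) {X Y : C} (f : X ⟶ Y) :
    F.functor.map f ≫ eqToHom (obj_eq h Y) = eqToHom (obj_eq h X) ≫ G.functor.map f := by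
  subst h
  simp

theorem ε_eqToHom_of_eq {F G : SymMonFunctor C D} (h : F = G) :
    ε F.functor ≫ eqToHom (obj_eq h (𝟙_ C)) = ε G.functor := by
  subst h
  simp

theorem μ_eqToHom_of_eq {F G : SymMonFunctor C D} (h : F = G) (X Y : C) :
    μ F.functor X Y ≫ eqToHom (obj_eq h (X ⊗ Y)) =
      (eqToHom (obj_eq h X) ⊗ₘ eqToHom (obj_eq h Y)) ≫ μ G.functor X Y := by
  subst h
  simp

theorem comp_assoc {E : Type u₃} [Category.{v₃} E] [MonoidalCategory E] [SymmetricCategory E]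
    {B : Type u} [Category.{v} B] [MonoidalCategory B] [SymmetricCategory B]
    (F : SymMonFunctor C D) (G : SymMonFunctor D E) (H : SymMonFunctor E B) :
    (F.comp G).comp H = F.comp (G.comp H) := by
  refine ext_of_eqToHom (fun _ => rfl) (fun f => ?_) ?_ fun X Y => ?_
  · exact (Category.comp_id _).trans (Category.id_comp _).symm
  · change (ε H.functor ≫ H.functor.map (ε G.functor ≫ G.functor.map (ε F.functor))) ≫ 𝟙 _ =
      (ε H.functor ≫ H.functor.map (ε G.functor)) ≫ H.functor.map (G.functor.map (ε F.functor))
    simp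
  · change (μ H.functor _ _ ≫ H.functor.map (μ G.functor _ _ ≫ G.functor.map (μ F.functor X Y))) ≫
      𝟙 _ = (𝟙 _ ⊗ₘ 𝟙 _) ≫ (μ H.functor _ _ ≫ H.functor.map (μ G.functor _ _)) ≫
        H.functor.map (G.functor.map (μ F.functor X Y))
    simp

end SymMonFunctor

namespace PropMap

open Functor.LaxMonoidal

variable {P : PropSystem.{w}} {Q : PropSystem.{w'}} (φ : PropMap P Q)
  {C : Type u} [Category.{v} C] [MonoidalCategory C] [SymmetricCategory C]

theorem ε_comp (F : SymMonFunctor Q.Cat C) :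
    ε (φ.toSymMon.comp F).functor = ε F.functor := by
  change ε F.functor ≫ F.functor.map (𝟙 _) = _
  rw [F.functor.map_id]
  exact Category.comp_id _

theorem μ_comp (F : SymMonFunctor Q.Cat C) (X Y : P.Cat) :
    μ (φ.toSymMon.comp F).functor X Y = μ F.functor ⟨X.ord⟩ ⟨Y.ord⟩ := by
  change μ F.functor ⟨X.ord⟩ ⟨Y.ord⟩ ≫ F.functor.map (𝟙 _) = _
  rw [F.functor.map_id]
  exact Category.comp_id _

variable {φ}

theorem obj_eq_of_comp_eq {F G : SymMonFunctor Q.Cat C}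
    (h : φ.toSymMon.comp F = φ.toSymMon.comp G) (X : Q.Cat) :
    F.functor.obj X = G.functor.obj X :=
  SymMonFunctor.obj_eq h ⟨X.ord⟩

/-- Functors that agree on the image of an identity-on-objects functor are equal if they agree on
all morphisms. -/
theorem eq_of_comp_eq {F G : SymMonFunctor Q.Cat C}
    (h : φ.toSymMon.comp F = φ.toSymMon.comp G)
    (hmap : ∀ {X Y : Q.Cat} (f : X ⟶ Y), F.functor.map f ≫ eqToHom (obj_eq_of_comp_eq h Y) =
      eqToHom (obj_eq_of_comp_eq h X) ≫ G.functor.map f) : F = G := by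
  -- Restriction along `φ` loses nothing of `ε` and `μ`, since `φ` is the identity on objects with
  -- identity structure maps.
  refine SymMonFunctor.ext_of_eqToHom (obj_eq_of_comp_eq h) hmap ?_ fun X Y => ?_
  · have := SymMonFunctor.ε_eqToHom_of_eq h
    rw [ε_comp, ε_comp] at this
    exact this
  · have := SymMonFunctor.μ_eqToHom_of_eq h ⟨X.ord⟩ ⟨Y.ord⟩
    rw [μ_comp, μ_comp] at this
    exact this

end PropMap

/-! ### The functor on dags -/

section DagFunctor

open Functor.LaxMonoidal

variable {C : Type u} [Category.{v} C] [MonoidalCategory C] [SymmetricCategory C]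
  (F : SymMonFunctor RelProp C) (lam : F.functor.obj ⟨1⟩ ⟶ F.functor.obj ⟨1⟩)
  {I O M J J' : Type} [Enumerated I] [Enumerated O] [Enumerated M] [Enumerated J'] [Enumerated J]

/-- The interpretation of an abstract dag. -/
noncomputable def AbstractDag.eval : AbstractDag I O → (evalObj F I ⟶ evalObj F O) :=
  Quotient.lift (IDag.eval F lam) fun _ _ ⟨σ, h⟩ => IDag.eval_congr σ h

theorem AbstractDag.eval_concat (D : AbstractDag I M) (D' : AbstractDag M O) :
    (D.concat D').eval F lam = D.eval F lam ≫ D'.eval F lam := by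
  obtain ⟨D, rfl⟩ := D.mk_surj
  obtain ⟨D', rfl⟩ := D'.mk_surj
  exact IDag.eval_concat D D'

theorem AbstractDag.eval_ofRel (R : I → O → Prop) :
    (AbstractDag.ofRel R).eval F lam = evalRel F R :=
  IDag.eval_ofRel R

theorem AbstractDag.eval_juxt_ofRel (D : AbstractDag I O) (S : J → J' → Prop) :
    (D.juxt (AbstractDag.ofRel S)).eval F lam = evalTens F (D.eval F lam) (evalRel F S) := by
  obtain ⟨D, rfl⟩ := D.mk_surj
  exact IDag.eval_juxt_ofRel D S

/-- The functor on dags given by a functor on relations and a node. -/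
noncomputable def dagFunctor : DagProp ⥤ C where
  obj X := F.functor.obj ⟨X.ord⟩
  map {X Y} f := AbstractDag.eval F lam (I := Fin X.ord) (O := Fin Y.ord) f
  map_id _ := (AbstractDag.eval_ofRel F lam _).trans (F.functor.map_id _)
  map_comp _ _ := AbstractDag.eval_concat F lam _ _

theorem dagFunctor_map_rel {n m : ℕ} (R : (⟨n⟩ : RelProp) ⟶ ⟨m⟩) :
    (dagFunctor F lam).map (relToDag.functor.map R) = F.functor.map R :=
  AbstractDag.eval_ofRel F lam (I := Fin n) (O := Fin m) _

/-- `finSumFinEquiv` is itself the enumeration of `Fin a ⊕ Fin b`. Hence the bijections conjugating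
in `PropSystem.tensMap` are invisible to the interpretation. -/
theorem relHom_finSumFinEquiv (a b : ℕ) :
    relHom (fun (x : Fin a ⊕ Fin b) (y : Fin (a + b)) => finSumFinEquiv x = y) =
      𝟙 (⟨a + b⟩ : RelProp) := by
  refine (relHom_equiv _).trans (congrArg relSystem.ofEquiv (symm_trans_eq ?_))
  ext x
  rcases x with x | x <;> rfl

theorem relHom_finSumFinEquiv_symm (a b : ℕ) :
    relHom (fun (x : Fin (a + b)) (y : Fin a ⊕ Fin b) => finSumFinEquiv.symm x = y) =
      𝟙 (⟨a + b⟩ : RelProp) := by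
  refine (relHom_equiv _).trans (congrArg relSystem.ofEquiv (symm_trans_eq ?_))
  ext x
  obtain ⟨x | x, rfl⟩ := finSumFinEquiv.surjective x <;>
    simp only [Equiv.trans_apply, Equiv.symm_apply_apply] <;> rfl

theorem evalRel_finSumFinEquiv (a b : ℕ) :
    evalRel F (fun (x : Fin a ⊕ Fin b) (y : Fin (a + b)) => finSumFinEquiv x = y) = 𝟙 _ :=
  (congrArg F.functor.map (relHom_finSumFinEquiv a b)).trans (F.functor.map_id _)

theorem evalRel_finSumFinEquiv_symm (a b : ℕ) :
    evalRel F (fun (x : Fin (a + b)) (y : Fin a ⊕ Fin b) => finSumFinEquiv.symm x = y) = 𝟙 _ :=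
  (congrArg F.functor.map (relHom_finSumFinEquiv_symm a b)).trans (F.functor.map_id _)

theorem AbstractDag.eval_tensMap_id {a b : ℕ} (f : AbstractDag (Fin a) (Fin b)) (c : ℕ) :
    AbstractDag.eval F lam (I := Fin (a + c)) (O := Fin (b + c))
      (PropSystem.tensMap (P := dagSystem) f (dagSystem.ofEquiv (Equiv.refl (Fin c)))) =
      evalTens F (f.eval F lam) (𝟙 (evalObj F (Fin c))) := by
  change AbstractDag.eval F lam (AbstractDag.concat (AbstractDag.ofRel fun i m =>
    finSumFinEquiv.symm i = m) (AbstractDag.concat (f.juxt (AbstractDag.ofRel fun i o => i = o))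
        (AbstractDag.ofRel fun i m => finSumFinEquiv i = m))) = _
  rw [AbstractDag.eval_concat, AbstractDag.eval_concat, AbstractDag.eval_ofRel,
    AbstractDag.eval_ofRel, AbstractDag.eval_juxt_ofRel, evalRel_id,
    evalRel_finSumFinEquiv, evalRel_finSumFinEquiv_symm]
  exact (Category.id_comp _).trans (Category.comp_id _)

theorem dagFunctor_map_whiskerRight {X Y : DagProp} (f : X ⟶ Y) (Z : DagProp) :
    (dagFunctor F lam).map (f ▷ Z) =
      evalTens F (V := Fin X.ord) (W := Fin Y.ord) (V' := Fin Z.ord) ((dagFunctor F lam).map f)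
        (𝟙 _) :=
  AbstractDag.eval_tensMap_id F lam _ _

theorem dagFunctor_whiskerRight {X Y : DagProp} (f : X ⟶ Y) (Z : DagProp) :
    (dagFunctor F lam).map f ▷ (dagFunctor F lam).obj Z ≫ μ F.functor ⟨Y.ord⟩ ⟨Z.ord⟩ =
      μ F.functor ⟨X.ord⟩ ⟨Z.ord⟩ ≫ (dagFunctor F lam).map (f ▷ Z) := by
  rw [dagFunctor_map_whiskerRight, ← tensorHom_id]
  exact (Functor.Monoidal.μ_δ_assoc F.functor _ _ _).symm

theorem whiskerLeft_comp_of_braiding {x y z p q p' q' : C} {f : x ⟶ y} {m₁ : z ⊗ x ⟶ p}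
    {m₂ : x ⊗ z ⟶ q} {m₃ : y ⊗ z ⟶ q'} {m₄ : z ⊗ y ⟶ p'} {b : p ⟶ q} {b' : q' ⟶ p'} {g : q ⟶ q'}
    (hb : m₁ ≫ b = (β_ z x).hom ≫ m₂) (hb' : m₃ ≫ b' = (β_ y z).hom ≫ m₄)
    (h : f ▷ z ≫ m₃ = m₂ ≫ g) : z ◁ f ≫ m₄ = m₁ ≫ b ≫ g ≫ b' := by
  rw [← Category.assoc m₁, hb, Category.assoc, ← Category.assoc m₂, ← h, Category.assoc, hb']
  simp

theorem dagFunctor_braiding (X Y : DagProp) :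
    (dagFunctor F lam).map (β_ X Y).hom =
      F.functor.map (β_ (⟨X.ord⟩ : RelProp) ⟨Y.ord⟩).hom :=
  dagFunctor_map_rel F lam (β_ (⟨X.ord⟩ : RelProp) ⟨Y.ord⟩).hom

/-- Left whiskering is right whiskering conjugated by braidings. These come from `RelProp`, where
`F` is already braided. -/
theorem dagFunctor_whiskerLeft {X Y : DagProp} (Z : DagProp) (f : X ⟶ Y) :
    (dagFunctor F lam).obj Z ◁ (dagFunctor F lam).map f ≫ μ F.functor ⟨Z.ord⟩ ⟨Y.ord⟩ =
      μ F.functor ⟨Z.ord⟩ ⟨X.ord⟩ ≫ (dagFunctor F lam).map (Z ◁ f) := by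
  have h₁ : Z ◁ f = (β_ Z X).hom ≫ f ▷ Z ≫ (β_ Y Z).hom := by simp
  rw [h₁, Functor.map_comp, Functor.map_comp, dagFunctor_braiding, dagFunctor_braiding]
  have hb := Functor.LaxBraided.braided (F := F.functor) (⟨Z.ord⟩ : RelProp) ⟨X.ord⟩
  have hb' := Functor.LaxBraided.braided (F := F.functor) (⟨Y.ord⟩ : RelProp) ⟨Z.ord⟩
  exact whiskerLeft_comp_of_braiding hb hb' (dagFunctor_whiskerRight F lam f Z)

/-- The strong monoidal structure of the functor on dags is that of the functor on relations. -/
noncomputable def dagFunctorCore : (dagFunctor F lam).CoreMonoidal where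
  εIso := Functor.Monoidal.εIso F.functor
  μIso X Y := Functor.Monoidal.μIso F.functor ⟨X.ord⟩ ⟨Y.ord⟩
  μIso_hom_natural_left f Z := dagFunctor_whiskerRight F lam f Z
  μIso_hom_natural_right Z f := dagFunctor_whiskerLeft F lam Z f
  associativity X Y Z := by
    -- The associator is the image of the one of `RelProp`, so this axiom is that of `F`; likewise
    -- for the unitors.
    have h : (dagFunctor F lam).map (α_ X Y Z).hom =
      F.functor.map (α_ (⟨X.ord⟩ : RelProp) ⟨Y.ord⟩ ⟨Z.ord⟩).hom :=
      dagFunctor_map_rel F lam (α_ (⟨X.ord⟩ : RelProp) ⟨Y.ord⟩ ⟨Z.ord⟩).hom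
    rw [h]
    exact Functor.LaxMonoidal.associativity (F := F.functor) ⟨X.ord⟩ ⟨Y.ord⟩ ⟨Z.ord⟩
  left_unitality X := by
    have h : (dagFunctor F lam).map (λ_ X).hom = F.functor.map (λ_ (⟨X.ord⟩ : RelProp)).hom :=
      dagFunctor_map_rel F lam (λ_ (⟨X.ord⟩ : RelProp)).hom
    rw [h]
    exact Functor.LaxMonoidal.left_unitality (F := F.functor) ⟨X.ord⟩
  right_unitality X := by
    have h : (dagFunctor F lam).map (ρ_ X).hom = F.functor.map (ρ_ (⟨X.ord⟩ : RelProp)).hom :=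
      dagFunctor_map_rel F lam (ρ_ (⟨X.ord⟩ : RelProp)).hom
    rw [h]
    exact Functor.LaxMonoidal.right_unitality (F := F.functor) ⟨X.ord⟩

noncomputable instance : (dagFunctor F lam).Braided where
  __ := (dagFunctorCore F lam).toMonoidal
  braided X Y := by
    rw [dagFunctor_braiding]
    exact Functor.LaxBraided.braided (F := F.functor) ⟨X.ord⟩ ⟨Y.ord⟩

/-- The functor on dags as a symmetric monoidal functor. -/
noncomputable def dagSymMon : SymMonFunctor DagProp C where
  functor := dagFunctor F lam

theorem relToDag_comp_dagSymMon : relToDag.toSymMon.comp (dagSymMon F lam) = F := by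
  refine SymMonFunctor.ext_of_eqToHom (fun _ => rfl) (fun f => ?_) ?_ fun X Y => ?_
  · exact (Category.comp_id _).trans ((dagFunctor_map_rel F lam f).trans (Category.id_comp _).symm)
  · rw [PropMap.ε_comp]
    exact Category.comp_id _
  · rw [PropMap.μ_comp]
    refine (Category.comp_id _).trans (Eq.trans ?_ (congrArg (· ≫ _) (id_tensorHom_id _ _).symm))
    exact (Category.id_comp _).symm

theorem dagSymMon_map_singleNode : (dagSymMon F lam).functor.map singleNode.toHom = lam :=
  IDag.eval_singleNode

end DagFunctor

/-! ### Functors on decorated bijections -/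

/-- Conjugating by a transposition moves the node from the last strand to any other. Such nodes
compose to every word decoration of the identity, and a bijection follows. -/
theorem NodeHom.fin_induction {p : ∀ {n m : ℕ}, NodeHom (Fin n) (Fin m) → Prop}
    (hperm : ∀ {n m : ℕ} (e : Fin n ≃ Fin m), p (NodeHom.ofEquiv e))
    (hcomp : ∀ {n m k : ℕ} (f : NodeHom (Fin n) (Fin m)) (g : NodeHom (Fin m) (Fin k)),
      p f → p g → p (f.comp g))
    (hlast : ∀ k : ℕ, p ⟨Equiv.refl (Fin (k + 1)), Pi.single (Fin.last k) 1⟩)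
    {n m : ℕ} (f : NodeHom (Fin n) (Fin m)) : p f := by
  have hsingle : ∀ {n : ℕ} (i : Fin n), p ⟨Equiv.refl (Fin n), Pi.single i 1⟩ := by
    intro n i
    obtain ⟨k, rfl⟩ : ∃ k, n = k + 1 := ⟨n - 1, by have := i.2; omega⟩
    have h := hcomp _ _ (hcomp _ _ (hperm (Equiv.swap i (Fin.last k))) (hlast k))
      (hperm (Equiv.swap i (Fin.last k)))
    convert h using 1
    refine NodeHom.ext ?_ (funext fun j => ?_)
    · ext j
      simp [NodeHom.comp, NodeHom.ofEquiv]
    · have : Equiv.swap i (Fin.last k) j = Fin.last k ↔ j = i := by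
        rw [Equiv.swap_apply_eq_iff, Equiv.swap_apply_right]
      simp [NodeHom.comp, NodeHom.ofEquiv, Pi.single_apply, this]
  have hword : ∀ (s n : ℕ) (w : Fin n → ℕ), ∑ i, w i = s → p ⟨Equiv.refl (Fin n), w⟩ := by
    intro s
    induction s with
    | zero =>
      intro n w hw
      have : w = fun _ => 0 := funext fun i => by simpa using (Finset.sum_eq_zero_iff.1 hw) i
      rw [this]
      exact hperm _
    | succ s ih =>
      intro n w hw
      obtain ⟨i, -, hi⟩ := Finset.exists_ne_zero_of_sum_ne_zero (hw.trans_ne s.succ_ne_zero)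
      -- The truncated subtraction is exact because `w i` is nonzero.
      let w' := w - Pi.single i 1
      have hw' : w' + Pi.single i 1 = w := by
        funext j
        by_cases hj : j = i
        · subst hj
          simp only [w', Pi.add_apply, Pi.sub_apply, Pi.single_eq_same]
          omega
        · simp [w', hj]
      have hs : ∑ j, w' j = s := by
        have h := hw
        rw [← hw'] at h
        simpa [Finset.sum_add_distrib] using h
      have h := hcomp _ _ (hsingle i) (ih n w' hs)
      convert h using 1
      exact NodeHom.ext rfl hw'.symm
  have h := hcomp _ _ (hword _ n f.word rfl) (hperm f.perm)
  convert h using 1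
  exact NodeHom.ext rfl (funext fun i => (Nat.zero_add _).symm)

/-- Exhibits the last generator of `NodeHom.fin_induction` as a whiskering, on which a monoidal
functor is controlled by its value at the node. -/
theorem whiskerLeft_nodeGen (k : ℕ) :
    (⟨k⟩ : NodeProp) ◁ nodeGen =
      (⟨Equiv.refl (Fin (k + 1)), Pi.single (Fin.last k) 1⟩ : NodeHom _ _) := by
  refine NodeHom.ext ?_ (funext fun i => ?_)
  · change finSumFinEquiv.symm.trans ((Equiv.sumCongr (Equiv.refl _) (Equiv.refl _)).trans
      finSumFinEquiv) = _
    refine symm_trans_eq ?_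
    ext x
    rcases x with x | x <;> rfl
  · change 0 + Sum.elim (fun _ => 0) (fun _ => 1) (finSumFinEquiv.symm i) + 0 =
      (Pi.single (Fin.last k) 1 : Fin (k + 1) → ℕ) i
    induction i using Fin.lastCases with
    | last =>
      have : finSumFinEquiv.symm (Fin.last k) = (Sum.inr 0 : Fin k ⊕ Fin 1) :=
        finSumFinEquiv_symm_apply_natAdd (m := k) (0 : Fin 1)
      rw [this]
      simp
    | cast i =>
      have : finSumFinEquiv.symm (Fin.castSucc i) = (Sum.inl i : Fin k ⊕ Fin 1) :=
        finSumFinEquiv_symm_apply_castAdd i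
      rw [this]
      simp [(Fin.castSucc_lt_last i).ne]

section

variable {C : Type u} [Category.{v} C] [MonoidalCategory C] [SymmetricCategory C]

open Functor.LaxMonoidal

/-- As `μ` is invertible and natural, the value at `Z ◁ f` is determined by the value at `f` and by
`μ`. -/
theorem SymMonFunctor.map_whiskerLeft_eqToHom {D : Type u₁} [Category.{v₁} D] [MonoidalCategory D]
    [SymmetricCategory D] {F G : SymMonFunctor D C}
    (hobj : ∀ X, F.functor.obj X = G.functor.obj X)
    (hμ : ∀ X Y, μ F.functor X Y ≫ eqToHom (hobj (X ⊗ Y)) =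
      (eqToHom (hobj X) ⊗ₘ eqToHom (hobj Y)) ≫ μ G.functor X Y) {X Y : D} {f : X ⟶ Y} (Z : D)
    (hf : F.functor.map f ≫ eqToHom (hobj Y) = eqToHom (hobj X) ≫ G.functor.map f) :
    F.functor.map (Z ◁ f) ≫ eqToHom (hobj (Z ⊗ Y)) =
      eqToHom (hobj (Z ⊗ X)) ≫ G.functor.map (Z ◁ f) := by
  rw [← cancel_epi (μ F.functor Z X), ← Category.assoc, ← μ_natural_right, Category.assoc, hμ,
    ← Category.assoc (μ F.functor Z X), hμ, Category.assoc, ← μ_natural_right, ← Category.assoc,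
    ← Category.assoc, ← id_tensorHom, ← id_tensorHom, tensorHom_comp_tensorHom,
    tensorHom_comp_tensorHom, hf]
  simp

/-- A symmetric monoidal functor on decorated bijections is determined by its restriction to
bijections and its value at the node. -/
theorem nodeProp_functor_ext {H H' : SymMonFunctor NodeProp C}
    (h : permToNode.toSymMon.comp H = permToNode.toSymMon.comp H')
    (hgen : H.functor.map nodeGen ≫ eqToHom (PropMap.obj_eq_of_comp_eq h _) =
      eqToHom (PropMap.obj_eq_of_comp_eq h _) ≫ H'.functor.map nodeGen) : H = H' := by
  refine PropMap.eq_of_comp_eq h fun {X Y} f => ?_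
  refine NodeHom.fin_induction (p := fun {n m} f => H.functor.map (X := ⟨n⟩) (Y := ⟨m⟩) f ≫
    eqToHom (PropMap.obj_eq_of_comp_eq h _) = eqToHom (PropMap.obj_eq_of_comp_eq h _) ≫
      H'.functor.map (X := ⟨n⟩) (Y := ⟨m⟩) f) ?_ ?_ ?_ f
  · intro n m e
    exact SymMonFunctor.map_eqToHom_of_eq h (X := ⟨n⟩) (Y := ⟨m⟩) e
  · intro n m k f g hf hg
    have hH := H.functor.map_comp (X := ⟨n⟩) (Y := ⟨m⟩) (Z := ⟨k⟩) f g
    have hH' := H'.functor.map_comp (X := ⟨n⟩) (Y := ⟨m⟩) (Z := ⟨k⟩) f g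
    refine (congrArg (· ≫ _) hH).trans (Eq.trans ?_ (congrArg (_ ≫ ·) hH').symm)
    rw [Category.assoc, hg, ← Category.assoc, hf, Category.assoc]
  · intro k
    rw [← whiskerLeft_nodeGen]
    refine SymMonFunctor.map_whiskerLeft_eqToHom (PropMap.obj_eq_of_comp_eq h) (fun X Y => ?_) ⟨k⟩
      hgen
    have := SymMonFunctor.μ_eqToHom_of_eq h ⟨X.ord⟩ ⟨Y.ord⟩
    rw [PropMap.μ_comp, PropMap.μ_comp] at this
    exact this

end

/-! ### Factorization of a sorted dag -/

namespace IDag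

/-- The edges of a dag that copies its inputs and gathers those in `p` at an additional node. -/
def gatherEdges {a : ℕ} (p : Fin a → Prop) : Fin a ⊕ Unit → Fin (a + 1) ⊕ Unit → Prop
  | .inl x, .inl y => y = Fin.castSucc x
  | .inl x, .inr _ => p x
  | .inr _, .inl y => y = Fin.last a
  | .inr _, .inr _ => False

/-- The dag that copies its inputs and gathers those in `p` at an additional node. -/
def gatherDag {a : ℕ} (p : Fin a → Prop) : IDag (Fin a) (Fin (a + 1)) where
  N := Unit
  R := gatherEdges p
  acyclic a h := by
    cases h with
    | single h => exact h
    | tail _ h => exact h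

theorem relIso_gatherEdges {a : ℕ} (p : Fin a → Prop) {R : Fin 1 ⊕ Unit → Fin 1 ⊕ Unit → Prop}
    (hR : ∀ x y, R x y ↔ x.isLeft = y.isRight) :
    RelIso ((Equiv.emptySum Empty (Empty ⊕ Unit)).trans (Equiv.emptySum Empty Unit))
      (concatRel (pureRel fun x y => y = Fin.castSucc x ∨ (y = Fin.last a ∧ p x)) fun x y =>
        juxtRel (pureRel fun i o : Fin a => i = o) R (Sum.map finSumFinEquiv.symm id x)
          (Sum.map finSumFinEquiv.symm id y))
      (gatherEdges p) := by
  have hs : ∀ x : Fin a, finSumFinEquiv.symm (Fin.castSucc x) = (Sum.inl x : Fin a ⊕ Fin 1) :=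
    fun x => finSumFinEquiv_symm_apply_castAdd x
  have hl : finSumFinEquiv.symm (Fin.last a) = (Sum.inr 0 : Fin a ⊕ Fin 1) :=
    finSumFinEquiv_symm_apply_natAdd (m := a) (0 : Fin 1)
  rintro (x | x | x | x) (y | y | y | y)
  all_goals try first | exact x.elim | exact y.elim
  · simp only [concatRel, pureRel, gatherEdges, Sum.map_inl, or_and_right, exists_or,
      exists_eq_left, and_assoc, hs, hl, id]
    induction y using Fin.lastCases with
    | last => simp [hl, juxtRel, regroup, hR, (Fin.castSucc_lt_last x).ne']
    | cast y => simp [hs, juxtRel, regroup, pureRel, eq_comm]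
  · simp [concatRel, pureRel, gatherEdges, or_and_right, exists_or, and_assoc, hs, hl, juxtRel,
      regroup, hR]
  · induction y using Fin.lastCases with
    | last => simp [concatRel, gatherEdges, hl, juxtRel, regroup, hR]
    | cast y => simp [concatRel, gatherEdges, hs, juxtRel, regroup, (Fin.castSucc_lt_last y).ne]
  · simp [concatRel, gatherEdges, juxtRel, regroup, hR]

/-- One stage of the sorted composite, written as an explicit dag with a single node. -/
theorem relToDag_comp_whiskerLeft_singleNode {a : ℕ} (p : Fin a → Prop) :
    relToDag.functor.map (X := ⟨a⟩) (Y := ⟨a + 1⟩)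
        (fun x y => y = Fin.castSucc x ∨ (y = Fin.last a ∧ p x)) ≫
      (⟨a⟩ : DagProp) ◁ singleNode.toHom = (gatherDag p).toHom := by
  have h : (⟨a⟩ : DagProp) ◁ singleNode.toHom = AbstractDag.mk
      ⟨Empty ⊕ Unit, fun x y => juxtRel (pureRel fun i o : Fin a => i = o) singleNode.R
        (Sum.map finSumFinEquiv.symm id x) (Sum.map finSumFinEquiv.symm id y),
        ((ofRel fun i o : Fin a => i = o).juxt singleNode).acyclic⟩ := by
    change AbstractDag.concat (AbstractDag.ofRel fun i m => finSumFinEquiv.symm i = m)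
      (AbstractDag.concat (AbstractDag.mk ((ofRel fun i o : Fin a => i = o).juxt singleNode))
        (AbstractDag.ofRel fun i m => finSumFinEquiv i = m)) = _
    rw [AbstractDag.concat_equiv, AbstractDag.equiv_concat]
    rfl
  rw [h]
  refine AbstractDag.sound (D' := gatherDag p) _ (relIso_gatherEdges p ?_)
  rintro (x | x) (y | y) <;> simp [singleNode]

namespace TopSort

variable {n m : ℕ} {D : IDag (Fin n) (Fin m)} (σ : D.TopSort)

/-- The edges of the dag `truncDag`. -/
def truncEdges (k : ℕ) (hk : k ≤ Nat.card D.N) (x : Fin n ⊕ Fin k) : Fin (n + k) ⊕ Fin k → Prop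
  | .inl y => finSumFinEquiv x = y
  | .inr l => D.R (Sum.map id (fun l => σ.toEquiv (Fin.castLE hk l)) x)
      (.inr (σ.toEquiv (Fin.castLE hk l)))

/-- The first `k` nodes of a sorted dag, with all inputs and all nodes copied to the output. -/
def truncDag (k : ℕ) (hk : k ≤ Nat.card D.N) : IDag (Fin n) (Fin (n + k)) where
  N := Fin k
  R := σ.truncEdges k hk
  acyclic _ h := D.acyclic _ (Relation.TransGen.lift
    (p := fun b c : D.N => D.R (.inr b) (.inr c)) (fun l => σ.toEquiv (Fin.castLE hk l))
    (fun _ _ h => h) _ _ h)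

/-- The composite of the first `k` stages of a sorted dag. -/
noncomputable def stageHom : ∀ k : ℕ, k ≤ Nat.card D.N → ((⟨n⟩ : DagProp) ⟶ ⟨n + k⟩)
  | 0, _ => 𝟙 _
  | k + 1, hk => stageHom k (Nat.le_of_succ_le hk) ≫
      relToDag.functor.map (σ.stepRel k hk) ≫ (⟨n + k⟩ : DagProp) ◁ singleNode.toHom

/-- A truncation exposes all its vertices as outputs, so the next node can be attached to any of
them by concatenating a gathering dag. -/
theorem relIso_truncEdges_succ (k : ℕ) (hk : k < Nat.card D.N) :
    RelIso ((Equiv.sumCongr (Equiv.refl _) (Equiv.ofUnique Unit (Fin 1))).trans finSumFinEquiv)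
      (concatRel (σ.truncEdges k hk.le)
        (gatherEdges fun x => D.R (σ.vertex k hk.le x) (.inr (σ.toEquiv ⟨k, hk⟩))))
      (σ.truncEdges (k + 1) hk) := by
  have hc : ∀ l : Fin k, Fin.castLE hk (Fin.castAdd 1 l) = Fin.castLE hk.le l := fun _ => rfl
  have hl : Fin.castLE hk (Fin.last k) = ⟨k, hk⟩ := rfl
  have hn : ∀ x : Fin 1, Fin.natAdd k x = Fin.last k := fun x => Fin.ext (by simp)
  rintro (x | x | x) (y | y | y)
  · simp only [concatRel, truncEdges, gatherEdges, exists_eq_left']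
    simp [Fin.ext_iff, eq_comm]
  · simp [concatRel, truncEdges, hc]
  · simp [concatRel, truncEdges, gatherEdges, vertex, hn, hl]
  · simp only [concatRel, truncEdges, gatherEdges, exists_eq_left']
    simp [Fin.ext_iff, eq_comm]
  · simp [concatRel, truncEdges, hc]
  · simp [concatRel, truncEdges, gatherEdges, vertex, hn, hl, hc]
  · simp only [concatRel, truncEdges, gatherEdges]
    simp [Fin.ext_iff, eq_comm]
  -- The sorting is used here and in the last case: the concatenation has no edge from the new node
  -- to an earlier one or to itself, so `D` must have none either.
  · simp only [concatRel, truncEdges, false_iff]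
    intro h
    have := σ.lt_of_edge _ _ h
    simp [Fin.lt_def] at this
    omega
  · simp only [concatRel, truncEdges, gatherEdges, false_iff]
    exact fun h => lt_irrefl _ (σ.lt_of_edge _ _ h)

theorem stageHom_eq (k : ℕ) (hk : k ≤ Nat.card D.N) :
    σ.stageHom k hk = (σ.truncDag k hk).toHom := by
  induction k with
  | zero =>
    have h : RelIso (Equiv.equivOfIsEmpty Empty (Fin 0)) (pureRel fun i o : Fin n => i = o)
        (σ.truncEdges 0 hk) := by
      rintro (x | x) (y | y)
      all_goals try first | exact x.elim | exact y.elim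
      exact Iff.rfl
    exact AbstractDag.sound (D := ofRel _) (D' := σ.truncDag 0 hk) _ h
  | succ k ih =>
    have h := relToDag_comp_whiskerLeft_singleNode
      fun x => D.R (σ.vertex k (Nat.le_of_succ_le hk) x) (.inr (σ.toEquiv ⟨k, hk⟩))
    rw [stageHom, ih]
    refine (congrArg (_ ≫ ·) h).trans ?_
    exact AbstractDag.sound (D := (σ.truncDag k _).concat (gatherDag _))
      (D' := σ.truncDag (k + 1) hk) _ (σ.relIso_truncEdges_succ k hk)

theorem relIso_truncEdges_lastRel :
    RelIso ((Equiv.sumEmpty _ Empty).trans σ.toEquiv)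
      (concatRel (σ.truncEdges (Nat.card D.N) le_rfl) (pureRel σ.lastRel)) D.R := by
  rintro (x | x | x) (y | y | y)
  all_goals try first | exact x.elim | exact y.elim
  all_goals simp [concatRel, truncEdges, pureRel, lastRel, vertex]

theorem stageHom_comp_lastRel :
    σ.stageHom (Nat.card D.N) le_rfl ≫ relToDag.functor.map σ.lastRel = D.toHom := by
  rw [stageHom_eq]
  exact AbstractDag.sound (D := (σ.truncDag _ le_rfl).concat (ofRel σ.lastRel)) (D' := D) _
    σ.relIso_truncEdges_lastRel

end TopSort

end IDag

/-! ### The value of a functor at a sorted dag -/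

section Squares

variable {C : Type u} [Category.{v} C]

theorem comp_square_two {X₀ X₁ X₂ Y₀ Y₁ Y₂ : C} {f : X₀ ⟶ X₁} {r : X₁ ⟶ X₂} {p₀ : X₀ ⟶ Y₀}
    {p₁ : X₁ ⟶ Y₁} {p₂ : X₂ ⟶ Y₂} {g : Y₀ ⟶ Y₁} {s : Y₁ ⟶ Y₂} (h₁ : f ≫ p₁ = p₀ ≫ g)
    (h₂ : r ≫ p₂ = p₁ ≫ s) : (f ≫ r) ≫ p₂ = p₀ ≫ g ≫ s := by
  rw [Category.assoc, h₂, ← Category.assoc, h₁, Category.assoc]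

theorem comp_square_three {X₀ X₁ X₂ X₃ Y₀ Y₁ Y₂ Y₃ : C} {f : X₀ ⟶ X₁} {r : X₁ ⟶ X₂} {k : X₂ ⟶ X₃}
    {p₀ : X₀ ⟶ Y₀} {p₁ : X₁ ⟶ Y₁} {p₂ : X₂ ⟶ Y₂} {p₃ : X₃ ⟶ Y₃} {g : Y₀ ⟶ Y₁} {s : Y₁ ⟶ Y₂}
    {l : Y₂ ⟶ Y₃} (h₁ : f ≫ p₁ = p₀ ≫ g) (h₂ : r ≫ p₂ = p₁ ≫ s) (h₃ : k ≫ p₃ = p₂ ≫ l) :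
    (f ≫ r ≫ k) ≫ p₃ = p₀ ≫ g ≫ s ≫ l :=
  comp_square_two h₁ (comp_square_two h₂ h₃)

theorem eqToHom_conj_comp {X Y : C} (p : X = Y) (g : Y ⟶ Y) :
    (eqToHom p ≫ g ≫ eqToHom p.symm) ≫ eqToHom p = eqToHom p ≫ g := by
  simp

end Squares

section Formula

open Functor.LaxMonoidal

variable {C : Type u} [Category.{v} C] [MonoidalCategory C] [SymmetricCategory C]

theorem semRel_comp_powIso (F : SymMonFunctor RelProp C) {a b : ℕ}
    (R : (⟨a⟩ : RelProp) ⟶ ⟨b⟩) :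
    semRel F R ≫ (powIso F b).hom = (powIso F a).hom ≫ F.functor.map R := by
  simp [semRel]

variable {n m : ℕ} {D : IDag (Fin n) (Fin m)} (σ : D.TopSort)

/-- `L` and `S` stand for the values of a functor on `DagProp` at whiskered nodes and at `stageHom`.
The induction needs only their recursion and the naturality of `μ`, because `powIso` adds its last
factor by `μ`. -/
theorem semStage_comp_powIso (F : SymMonFunctor RelProp C)
    (lam : F.functor.obj ⟨1⟩ ⟶ F.functor.obj ⟨1⟩)
    (L : ∀ a : ℕ, F.functor.obj ⟨a + 1⟩ ⟶ F.functor.obj ⟨a + 1⟩)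
    (hL : ∀ a, F.functor.obj ⟨a⟩ ◁ lam ≫ μ F.functor ⟨a⟩ ⟨1⟩ = μ F.functor ⟨a⟩ ⟨1⟩ ≫ L a)
    (S : ∀ k : ℕ, k ≤ Nat.card D.N → (F.functor.obj ⟨n⟩ ⟶ F.functor.obj ⟨n + k⟩))
    (hS₀ : ∀ h, S 0 h = 𝟙 _)
    (hS : ∀ k h, S (k + 1) h =
      S k (Nat.le_of_succ_le h) ≫ F.functor.map (σ.stepRel k h) ≫ L (n + k))
    (k : ℕ) (hk : k ≤ Nat.card D.N) :
    semStage F lam σ k hk ≫ (powIso F (n + k)).hom = (powIso F n).hom ≫ S k hk := by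
  induction k with
  | zero =>
    rw [hS₀]
    exact (Category.id_comp _).trans (Category.comp_id _).symm
  | succ k ih =>
    have h : (tensorPow (F.functor.obj ⟨1⟩) (n + k) ◁ lam) ≫ (powIso F (n + k + 1)).hom =
        (powIso F (n + k + 1)).hom ≫ L (n + k) := by
      refine (whisker_exchange_assoc _ _ _).trans ?_
      exact (congrArg (_ ≫ ·) (hL _)).trans (Category.assoc _ _ _).symm
    have hs : semStage F lam σ (k + 1) hk = semStage F lam σ k (Nat.le_of_succ_le hk) ≫
      semRel F (σ.stepRel k hk) ≫ (tensorPow (F.functor.obj ⟨1⟩) (n + k) ◁ lam) := rfl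
    rw [hS, hs]
    exact comp_square_three (ih _) (semRel_comp_powIso F _) h

theorem map_toHom_eq_semDag (K : SymMonFunctor DagProp C) :
    K.functor.map D.toHom =
      (powIso (relToDag.toSymMon.comp K) n).inv ≫
        semDag (relToDag.toSymMon.comp K) (K.functor.map singleNode.toHom) σ ≫
          (powIso (relToDag.toSymMon.comp K) m).hom := by
  have h := semStage_comp_powIso σ (relToDag.toSymMon.comp K) (K.functor.map singleNode.toHom)
    (fun a => K.functor.map ((⟨a⟩ : DagProp) ◁ singleNode.toHom))
    (fun a => by
      rw [PropMap.μ_comp]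
      exact μ_natural_right K.functor (⟨a⟩ : DagProp) singleNode.toHom)
    (fun k hk => K.functor.map (σ.stageHom k hk))
    (fun _ => K.functor.map_id _)
    (fun k hk => (K.functor.map_comp _ _).trans (congrArg (_ ≫ ·) (K.functor.map_comp _ _)))
    (Nat.card D.N) le_rfl
  refine (Iso.eq_inv_comp _).2
    (Eq.trans ?_ (comp_square_two h (semRel_comp_powIso _ σ.lastRel)).symm)
  exact congrArg (_ ≫ ·)
    ((congrArg K.functor.map σ.stageHom_comp_lastRel.symm).trans (K.functor.map_comp _ _))

end Formula

/-! ### Injectivity -/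

theorem permToRel_faithful : permToRel.toSymMon.functor.Faithful where
  map_injective {X Y} f g h := by
    refine Equiv.ext (α := Fin X.ord) (β := Fin Y.ord) fun x => ?_
    -- The two graphs are compared at the pair `(x, g x)`.
    have : (f.toFun x = g.toFun x) = (g.toFun x = g.toFun x) := congrFun (congrFun h x) (g.toFun x)
    exact this.mpr rfl

theorem permToNode_faithful : permToNode.toSymMon.functor.Faithful where
  map_injective {_ _} _ _ h := congrArg NodeHom.perm h

theorem relToDag_faithful : relToDag.toSymMon.functor.Faithful where
  map_injective {X Y} R S h := by
    obtain ⟨σ, hσ⟩ := Quotient.exact (s := IDag.setoid _ _) h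
    funext x y
    exact propext (hσ (.inl x) (.inl y))

namespace NodeHom

variable {I O : Type} {f g : NodeHom I O} {σ : f.Chain ≃ g.Chain}

/-- Induction along the strand: the input fixes the position of the first node, and each node that
of its successor. -/
theorem chain_eq_of_relIso (h : IDag.RelIso σ f.strandRel g.strandRel) (i : I) (a : ℕ)
    (ha : a < f.word i) : (σ ⟨(i, a), ha⟩).1 = (i, a) := by
  induction a with
  | zero => exact ((h (.inl i) (.inr ⟨(i, 0), ha⟩)).1 rfl).symm
  | succ a ih =>
    have := (h (.inr ⟨(i, a), Nat.lt_of_succ_lt ha⟩) (.inr ⟨(i, a + 1), ha⟩)).1 rfl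
    have hs : g.outGap (.inr (σ ⟨(i, a), Nat.lt_of_succ_lt ha⟩)) = (i, a + 1) := by
      rw [outGap, ih]
    exact this.symm.trans hs

/-- A longer strand in `f` would have a node at position `g.word i`, with no node of `g` at these
coordinates to go to. -/
theorem word_le_of_relIso (h : IDag.RelIso σ f.strandRel g.strandRel) (i : I) :
    f.word i ≤ g.word i := by
  by_contra! hlt
  have e := chain_eq_of_relIso h i (g.word i) hlt
  have := (σ ⟨(i, g.word i), hlt⟩).2
  rw [e] at this
  exact lt_irrefl _ this

theorem eq_of_relIso (h : IDag.RelIso σ f.strandRel g.strandRel) : f = g := by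
  have h' : IDag.RelIso σ.symm g.strandRel f.strandRel := fun x y => by simp [h _ _]
  have hw : f.word = g.word :=
    funext fun i => le_antisymm (word_le_of_relIso h i) (word_le_of_relIso h' i)
  refine NodeHom.ext (Equiv.ext fun i => ?_) hw
  -- The bijection is read off the edge into the output, which leaves the input itself if the word
  -- is empty and the node `(i, word i - 1)` otherwise.
  rcases hi : f.word i with _ | a
  · have := (h (.inl i) (.inl (f.perm i))).1 (by simp [strandRel, outGap, inGap, hi])
    have := congrArg Prod.fst this
    exact (Equiv.eq_symm_apply _).1 this |>.symm
  · have ha : a < f.word i := by omega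
    have := (h (.inr ⟨(i, a), ha⟩) (.inl (f.perm i))).1 (by simp [strandRel, outGap, inGap, hi])
    have := congrArg Prod.fst this
    have e := congrArg Prod.fst (chain_eq_of_relIso h i a ha)
    exact (Equiv.eq_symm_apply _).1 (e.symm.trans this) |>.symm

end NodeHom

theorem nodeToDag_faithful : nodeToDag.toSymMon.functor.Faithful where
  map_injective {X Y} f g h := by
    obtain ⟨σ, hσ⟩ := Quotient.exact (s := IDag.setoid _ _) h
    exact NodeHom.eq_of_relIso (σ := σ) hσ

/-- The single chain of the one-letter word has one node. -/
def nodeGenChain :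
    NodeHom.Chain (⟨Equiv.refl (Fin 1), fun _ => 1⟩ : NodeHom (Fin 1) (Fin 1)) ≃ Unit where
  toFun _ := ()
  invFun _ := ⟨(0, 0), Nat.one_pos⟩
  left_inv := by
    rintro ⟨⟨i, a⟩, h⟩
    refine Subtype.ext (Prod.ext (Subsingleton.elim _ _) ?_)
    simp only [Nat.lt_one_iff] at h
    exact h.symm
  right_inv _ := rfl

theorem relIso_nodeGenChain {R : Fin 1 ⊕ Unit → Fin 1 ⊕ Unit → Prop}
    (hR : ∀ x y, R x y ↔ x.isLeft = y.isRight) :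
    IDag.RelIso nodeGenChain (NodeHom.strandRel ⟨Equiv.refl (Fin 1), fun _ => 1⟩) R := by
  rintro (x | ⟨⟨x, a⟩, h⟩) (y | ⟨⟨y, b⟩, k⟩)
  · simp [NodeHom.strandRel, NodeHom.outGap, NodeHom.inGap, hR]
  · change _ ↔ R (.inl x) (.inr ())
    have hb : b = 0 := Nat.lt_one_iff.1 k
    simp [NodeHom.strandRel, NodeHom.outGap, NodeHom.inGap, hR, hb, Subsingleton.elim x y]
  · change _ ↔ R (.inr ()) (.inl y)
    have ha : a = 0 := Nat.lt_one_iff.1 h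
    simp [NodeHom.strandRel, NodeHom.outGap, NodeHom.inGap, hR, ha, Subsingleton.elim x y]
  · change _ ↔ R (.inr ()) (.inr ())
    have hb : b = 0 := Nat.lt_one_iff.1 k
    simp [NodeHom.strandRel, NodeHom.outGap, NodeHom.inGap, hR, hb]

theorem nodeToDag_map_nodeGen :
    nodeToDag.toSymMon.functor.map nodeGen = singleNode.toHom := by
  refine AbstractDag.sound (D' := singleNode) nodeGenChain (relIso_nodeGenChain ?_)
  rintro (x | x) (y | y) <;> simp [singleNode]

theorem permToRel_comp_relToDag :
    permToRel.toSymMon.comp relToDag.toSymMon = permToNode.toSymMon.comp nodeToDag.toSymMon := by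
  refine SymMonFunctor.ext_of_eqToHom (fun _ => rfl) (fun f => ?_) ?_ fun X Y => ?_
  · refine (Category.comp_id _).trans (Eq.trans ?_ (Category.id_comp _).symm)
    exact (nodeToDag.map_ofEquiv f).symm
  · rw [PropMap.ε_comp, PropMap.ε_comp]
    exact Category.comp_id _
  · rw [PropMap.μ_comp, PropMap.μ_comp]
    refine (Category.comp_id _).trans (Eq.trans ?_ (congrArg (· ≫ _) (id_tensorHom_id _ _).symm))
    exact (Category.id_comp _).symm

/-! ### The pushout -/

section Pushout

variable {C : Type u} [Category.{v} C] [MonoidalCategory C] [SymmetricCategory C]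
  {F : SymMonFunctor RelProp C} {H : SymMonFunctor NodeProp C}

/-- A mediating functor interprets dags by topological sorting. -/
theorem mediating_map (h : permToRel.toSymMon.comp F = permToNode.toSymMon.comp H)
    (K : SymMonFunctor DagProp C) (hF : relToDag.toSymMon.comp K = F)
    (hH : nodeToDag.toSymMon.comp K = H) {n m : ℕ} (D : IDag (Fin n) (Fin m)) (σ : D.TopSort) :
    K.functor.map D.toHom =
      eqToHom (mediating_obj_eq hF n) ≫ (powIso F n).inv ≫ semDag F (coneNode h) σ ≫
        (powIso F m).hom ≫ eqToHom (mediating_obj_eq hF m).symm := by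
  -- With `F` and `H` replaced by restrictions of `K`, all transports along equalities of objects
  -- are identities.
  subst hF hH
  have hn : coneNode h = K.functor.map singleNode.toHom := by
    rw [← nodeToDag_map_nodeGen]
    exact (Category.id_comp _).trans (Category.comp_id _)
  rw [hn, map_toHom_eq_semDag σ K]
  refine Eq.trans ?_ (Category.id_comp _).symm
  exact congrArg (fun f => _ ≫ _ ≫ f) (Category.comp_id _).symm

/-- Each dag has some topological sorting, and the formula attached to it mentions only `F` and `H`.
-/
theorem mediating_unique (h : permToRel.toSymMon.comp F = permToNode.toSymMon.comp H)
    {K K' : SymMonFunctor DagProp C} (hF : relToDag.toSymMon.comp K = F)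
    (hH : nodeToDag.toSymMon.comp K = H) (hF' : relToDag.toSymMon.comp K' = F)
    (hH' : nodeToDag.toSymMon.comp K' = H) : K = K' := by
  refine PropMap.eq_of_comp_eq (hF.trans hF'.symm) fun {X Y} f => ?_
  obtain ⟨D, rfl⟩ : ∃ D : IDag (Fin X.ord) (Fin Y.ord), f = D.toHom := AbstractDag.mk_surj f
  obtain ⟨σ⟩ := D.nonempty_topSort
  refine (congrArg (· ≫ _) (mediating_map h K hF hH D σ)).trans
    (Eq.trans ?_ (congrArg (_ ≫ ·) (mediating_map h K' hF' hH' D σ)).symm)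
  simp

theorem existsUnique_mediating (h : permToRel.toSymMon.comp F = permToNode.toSymMon.comp H) :
    ∃! K : SymMonFunctor DagProp C,
      relToDag.toSymMon.comp K = F ∧ nodeToDag.toSymMon.comp K = H := by
  have hF := relToDag_comp_dagSymMon F (coneNode h)
  -- Agreement on bijections is obtained through the other side of the square, where the restriction
  -- is already known to be `F`.
  have hP : permToNode.toSymMon.comp (nodeToDag.toSymMon.comp (dagSymMon F (coneNode h))) =
      permToNode.toSymMon.comp H := by
    rw [← SymMonFunctor.comp_assoc, ← permToRel_comp_relToDag, SymMonFunctor.comp_assoc, hF, h]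
  have hH : nodeToDag.toSymMon.comp (dagSymMon F (coneNode h)) = H := by
    refine nodeProp_functor_ext hP ?_
    have hg : (nodeToDag.toSymMon.comp (dagSymMon F (coneNode h))).functor.map nodeGen =
        coneNode h :=
      (congrArg _ nodeToDag_map_nodeGen).trans (dagSymMon_map_singleNode F (coneNode h))
    rw [hg]
    exact eqToHom_conj_comp (cone_obj_eq h 1) (H.functor.map nodeGen)
  exact ⟨_, ⟨hF, hH⟩, fun K hK => mediating_unique h hK.1 hK.2 hF hH⟩

end Pushout

theorem mainTheorem2 :
    -- the four functors are injections of PROPs (all of them are the identity on objects)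
    permToRel.toSymMon.functor.Faithful ∧ permToNode.toSymMon.functor.Faithful ∧
    relToDag.toSymMon.functor.Faithful ∧ nodeToDag.toSymMon.functor.Faithful ∧
    nodeToDag.toSymMon.functor.map nodeGen = singleNode.toHom ∧
    -- the square commutes
    permToRel.toSymMon.comp relToDag.toSymMon = permToNode.toSymMon.comp nodeToDag.toSymMon ∧
    -- every finite dag has a topological sorting
    (∀ (n m : ℕ) (D : IDag (Fin n) (Fin m)), Nonempty D.TopSort) ∧
    -- the square is a pushout, and the mediating functor interprets dags by topological sorting
    ∀ (C : Type u) [Category.{v} C] [MonoidalCategory C] [SymmetricCategory C]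
      (F : SymMonFunctor RelProp C) (H : SymMonFunctor NodeProp C)
      (h : permToRel.toSymMon.comp F = permToNode.toSymMon.comp H),
      (∃! K : SymMonFunctor DagProp C,
        relToDag.toSymMon.comp K = F ∧ nodeToDag.toSymMon.comp K = H) ∧
      ∀ (K : SymMonFunctor DagProp C) (hF : relToDag.toSymMon.comp K = F),
        nodeToDag.toSymMon.comp K = H →
        ∀ (n m : ℕ) (D : IDag (Fin n) (Fin m)) (σ : D.TopSort),
          K.functor.map D.toHom =
            eqToHom (mediating_obj_eq hF n) ≫ (powIso F n).inv ≫
              semDag F (coneNode h) σ ≫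
                (powIso F m).hom ≫ eqToHom (mediating_obj_eq hF m).symm := by
  refine ⟨permToRel_faithful, permToNode_faithful, relToDag_faithful, nodeToDag_faithful,
    nodeToDag_map_nodeGen, permToRel_comp_relToDag, fun _ _ D => D.nonempty_topSort, ?_⟩
  intro C _ _ _ F H h
  exact ⟨existsUnique_mediating h, fun K hF hH _ _ D σ => mediating_map h K hF hH D σ⟩
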